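/- Let $R$ be a commutative artinian ring which is injective as a module over itself, let $G$ be a finite group, and let $\iota\colon R\to RG$ be the inclusion into the group algebra. Write $\operatorname{mod} RG$ for the category of finitely generated $RG$-modules, and for an $R$-module $M$ put $\iota^*M=RG\otimes_R M$. Consider two classes of short exact sequences in $\operatorname{mod}RG$: all of them, and the $R$-split ones, i.e. those which split as sequences of $R$-modules. For each class, the associated stable category has the finitely generated $RG$-modules as objects and, as morphisms, the $RG$-linear maps modulo those factoring through an object that is both projective and injective with respect to the class. The stable category is $\operatorname{stmod}RG$ for the class of all short exact sequences, and the relative stable category $\operatorname{stbik}RG$ for the $R$-split ones. Each of them is a triangulated category whose suspension is the cosyzygy functor of the class and whose distinguished triangles are, up to isomorphism, the sequences $X\to Y\to Z\to\Sigma X$ arising from the short exact sequences $0\to X\to Y\to Z\to 0$ in the class, with connecting maps natural in the short exact sequence. Let $\mathcal K=\operatorname{thick}_{\operatorname{stmod}RG}(\iota^*M \mid M \text{ a finitely generated } R\text{-module})$ be the smallest triangulated subcategory of $\operatorname{stmod}RG$ that is closed under direct summands and contains all $\iota^*M$, and let $\mathcal K'$ be the full subcategory of $\operatorname{stbik}RG$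 with the same objects as $\mathcal K$. Let $\psi\colon \operatorname{mod}RG\to(\operatorname{stmod}RG)/\mathcal K$ be the composite of the canonical functor $\operatorname{mod}RG\to\operatorname{stmod}RG$ with the Verdier quotient functor. Then $\mathcal K'$ is a thick subcategory of $\operatorname{stbik}RG$; the functor $\psi$ factors, up to natural isomorphism, through the canonical functor $\operatorname{mod}RG\to\operatorname{stbik}RG$ and an exact functor $\underline\psi\colon\operatorname{stbik}RG\to(\operatorname{stmod}RG)/\mathcal K$; and $\underline\psi$ factors, up to an isomorphism of exact functors, through the Verdier quotient functor $\operatorname{stbik}RG\to(\operatorname{stbik}RG)/\mathcal K'$ and an equivalence of triangulated categories $$\phi\colon(\operatorname{stbik}RG)/\mathcal K'\xrightarrow{\ \sim\ }(\operatorname{stmod}RG)/\mathcal K .$$ -/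

import Mathlib

open CategoryTheory CategoryTheory.Limits CategoryTheory.Pretriangulated ZeroObject
open scoped TensorProduct

universe u v u' v'

/-! ### Stable categories relative to a class of short exact sequences -/

section Stable

variable {A : Type u'} [Category.{v'} A] [Preadditive A]

/-- `X` is projective with respect to a class `E` of short exact sequences `X₁ ⟶ X₂ ⟶ X₃`:
maps from `X` lift along every `X₂ ⟶ X₃`. -/
def RelProjective (E : ObjectProperty (ShortComplex A)) (X : A) : Prop :=
  ∀ S : ShortComplex A, E S → ∀ a : X ⟶ S.X₃, ∃ b : X ⟶ S.X₂, b ≫ S.g = a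

/-- `X` is injective with respect to a class `E` of short exact sequences `X₁ ⟶ X₂ ⟶ X₃`:
maps into `X` extend along every `X₁ ⟶ X₂`. -/
def RelInjective (E : ObjectProperty (ShortComplex A)) (X : A) : Prop :=
  ∀ S : ShortComplex A, E S → ∀ a : S.X₁ ⟶ X, ∃ b : S.X₂ ⟶ X, S.f ≫ b = a

/-- The objects which are both projective and injective with respect to `E`. -/
def RelProjInj (E : ObjectProperty (ShortComplex A)) : ObjectProperty A :=
  fun X => RelProjective E X ∧ RelInjective E X

/-- Two parallel maps are identified in the stable category if their difference factors
through a projective-injective object. -/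
def stableRel (E : ObjectProperty (ShortComplex A)) : HomRel A := fun X Y f g =>
  ∃ (I : A) (_ : RelProjInj E I) (a : X ⟶ I) (b : I ⟶ Y), f - g = a ≫ b

/-- The stable category of `(A, E)`: the objects of `A`, with the maps of `A` modulo those
that factor through a projective-injective object. -/
abbrev StableCat (E : ObjectProperty (ShortComplex A)) := Quotient (stableRel E)

/-- The canonical functor to the stable category: the identity on objects. -/
abbrev toStable (E : ObjectProperty (ShortComplex A)) : A ⥤ StableCat E :=
  Quotient.functor (stableRel E)

lemma relProjInj_zero [HasZeroObject A] (E : ObjectProperty (ShortComplex A)) : RelProjInj E (0 : A) :=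
  ⟨fun _ _ _ => ⟨0, (isZero_zero A).eq_of_src _ _⟩,
    fun _ _ _ => ⟨0, (isZero_zero A).eq_of_tgt _ _⟩⟩

lemma relProjInj_biprod [HasBinaryBiproducts A] (E : ObjectProperty (ShortComplex A))
    {X Y : A} (hX : RelProjInj E X) (hY : RelProjInj E Y) :
    RelProjInj E (X ⊞ Y) := by
  constructor
  · intro S hS a
    obtain ⟨b, hb⟩ := hX.1 S hS (biprod.inl ≫ a)
    obtain ⟨c, hc⟩ := hY.1 S hS (biprod.inr ≫ a)
    exact ⟨biprod.desc b c, by ext <;> simp [hb, hc]⟩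
  · intro S hS a
    obtain ⟨b, hb⟩ := hX.2 S hS (a ≫ biprod.fst)
    obtain ⟨c, hc⟩ := hY.2 S hS (a ≫ biprod.snd)
    exact ⟨biprod.lift b c, by ext <;> simp [hb, hc]⟩

lemma stableRel_add [HasBinaryBiproducts A] (E : ObjectProperty (ShortComplex A))
    {X Y : A} (f₁ f₂ g₁ g₂ : X ⟶ Y) (hf : stableRel E f₁ f₂)
    (hg : stableRel E g₁ g₂) : stableRel E (f₁ + g₁) (f₂ + g₂) := by
  obtain ⟨I, hI, a, b, h⟩ := hf
  obtain ⟨J, hJ, c, d, h'⟩ := hg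
  refine ⟨I ⊞ J, relProjInj_biprod E hI hJ, biprod.lift a c, biprod.desc b d, ?_⟩
  rw [biprod.lift_desc, ← h, ← h']
  abel

variable [HasZeroObject A] [HasBinaryBiproducts A] (E : ObjectProperty (ShortComplex A))

instance stableRel_congruence : Congruence (stableRel E) where
  equivalence :=
    { refl := fun f => ⟨0, relProjInj_zero E, 0, 0, by simp⟩
      symm := by
        rintro f g ⟨I, hI, a, b, h⟩
        exact ⟨I, hI, -a, b, by rw [Preadditive.neg_comp, ← h]; abel⟩
      trans := by
        intro f g h hfg hgh
        obtain ⟨I, hI, a, b, e⟩ := stableRel_add E _ _ _ _ hfg hgh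
        exact ⟨I, hI, a, b, by rw [← e]; abel⟩ }
  comp_left := by
    rintro X Y Z f g g' ⟨I, hI, a, b, h⟩
    exact ⟨I, hI, f ≫ a, b, by rw [← Preadditive.comp_sub, h, Category.assoc]⟩
  comp_right := by
    rintro X Y Z f f' g ⟨I, hI, a, b, h⟩
    exact ⟨I, hI, a, b ≫ g, by rw [← Preadditive.sub_comp, h, Category.assoc]⟩

instance stableCat_preadditive : Preadditive (StableCat E) :=
  Quotient.preadditive _ (fun _ _ f₁ f₂ g₁ g₂ => stableRel_add E f₁ f₂ g₁ g₂)

instance toStable_additive : (toStable E).Additive :=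
  Quotient.functor_additive _ (fun _ _ f₁ f₂ g₁ g₂ => stableRel_add E f₁ f₂ g₁ g₂)

instance stableCat_hasZeroObject : HasZeroObject (StableCat E) :=
  ⟨⟨(toStable E).obj 0, (toStable E).map_isZero (isZero_zero A)⟩⟩

/-- A realisation of the triangulated structure of the stable category of the Frobenius category
`(A, E)`: the distinguished triangles are, up to isomorphism, the sequences
`X₁ ⟶ X₂ ⟶ X₃ ⟶ X₁⟦1⟧` arising from the members of `E`, the connecting maps being natural in the
short exact sequence.

For a short exact sequence `X ⟶ I ⟶ C` in `E` with `I` projective-injective, the middle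
term vanishes in the stable category, so that the connecting map is an isomorphism from the
cosyzygy `C` of `X` to the suspension `X⟦1⟧`, natural in `X`. By naturality, the connecting map
of any `X ⟶ Y ⟶ Z` in `E` is then the map induced by extending `X ⟶ I` to `Y`. Hence the suspension
is the cosyzygy functor, and the structure is determined up to equivalence of
triangulated categories. -/
class StableTriangulation where
  /-- the suspension -/
  hasShift : HasShift (StableCat E) ℤ
  additive : ∀ n : ℤ, (shiftFunctor (StableCat E) n).Additive
  /-- the distinguished triangles -/
  pretriangulated : Pretriangulated (StableCat E)
  isTriangulated : IsTriangulated (StableCat E)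
  /-- the connecting map of a short exact sequence -/
  δ : ∀ S : ShortComplex A, E S →
    ((toStable E).obj S.X₃ ⟶ ((toStable E).obj S.X₁)⟦(1 : ℤ)⟧)
  δ_naturality : ∀ (S S' : ShortComplex A) (hS : E S) (hS' : E S') (φ : S ⟶ S'),
    (toStable E).map φ.τ₃ ≫ δ S' hS' = δ S hS ≫ ((toStable E).map φ.τ₁)⟦(1 : ℤ)⟧'
  distinguished_iff : ∀ T : Triangle (StableCat E), T ∈ distTriang (StableCat E) ↔
    ∃ (S : ShortComplex A) (hS : E S), Nonempty (T ≅
      Triangle.mk ((toStable E).map S.f) ((toStable E).map S.g) (δ S hS))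

attribute [reducible] StableTriangulation.hasShift StableTriangulation.pretriangulated

attribute [instance] StableTriangulation.hasShift StableTriangulation.additive
  StableTriangulation.pretriangulated StableTriangulation.isTriangulated

end Stable

/-! ### Finitely generated modules over a group algebra -/

instance fgModuleCat_hasZeroObject (Λ : Type u) [Ring Λ] : HasZeroObject (FGModuleCat.{v} Λ) := by
  refine ⟨⟨FGModuleCat.of Λ PUnit, ?_⟩⟩
  rw [IsZero.iff_id_eq_zero]
  ext

instance fgModuleCat_hasBinaryBiproducts (Λ : Type u) [Ring Λ] :
    HasBinaryBiproducts (FGModuleCat.{v} Λ) := by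
  refine ⟨fun X Y => ?_⟩
  let b : BinaryBicone X Y :=
    { pt := FGModuleCat.of Λ (X × Y)
      fst := FGModuleCat.ofHom (LinearMap.fst Λ X Y)
      snd := FGModuleCat.ofHom (LinearMap.snd Λ X Y)
      inl := FGModuleCat.ofHom (LinearMap.inl Λ X Y)
      inr := FGModuleCat.ofHom (LinearMap.inr Λ X Y)
      inl_fst := by ext x; rfl
      inl_snd := by ext x; rfl
      inr_fst := by ext x; rfl
      inr_snd := by ext x; rfl }
  exact hasBinaryBiproduct_of_total b (FGModuleCat.hom_ext (LinearMap.ext fun x =>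
    Prod.ext (add_zero (Prod.fst x)) (zero_add (Prod.snd x))))

section GroupAlgebra

variable (R : Type u) [CommRing R] (G : Type v) [Group G]

/-- The category `mod RG` of finitely generated modules over the group algebra. -/
abbrev ModRG := FGModuleCat.{max u v} (MonoidAlgebra R G)

/-- Restriction `ι_*` along `ι : R → RG`, from `mod RG` to `R`-modules. -/
noncomputable abbrev restrictToR : ModRG R G ⥤ ModuleCat.{max u v} R :=
  forget₂ (ModRG R G) (ModuleCat.{max u v} (MonoidAlgebra R G)) ⋙
    ModuleCat.restrictScalars (algebraMap R (MonoidAlgebra R G))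

/-- The induced module `ι^* M = RG ⊗_R M`. -/
noncomputable abbrev inducedModule (M : FGModuleCat.{max u v} R) : ModRG R G :=
  FGModuleCat.of (MonoidAlgebra R G) (MonoidAlgebra R G ⊗[R] M)

/-- The short exact sequences of finitely generated `RG`-modules. -/
def shortExactRG : ObjectProperty (ShortComplex (ModRG R G)) := fun S =>
  (S.map (forget₂ (ModRG R G) (ModuleCat.{max u v} (MonoidAlgebra R G)))).ShortExact

/-- The `R`-split short exact sequences of finitely generated `RG`-modules. -/
def splitExactRG : ObjectProperty (ShortComplex (ModRG R G)) := fun S =>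
  shortExactRG R G S ∧ Nonempty (S.map (restrictToR R G)).Splitting

/-- The usual stable category `stmod RG`. -/
abbrev StMod := StableCat (shortExactRG R G)

/-- The relative stable category of `RG`, defined by the `R`-split short exact sequences. -/
abbrev StBik := StableCat (splitExactRG R G)

/-- The objects `ι^* M` of `stmod RG`, with `M` a finitely generated `R`-module. -/
def inducedObj : ObjectProperty (StMod R G) := fun X =>
  ∃ M : FGModuleCat.{max u v} R, X = (toStable (shortExactRG R G)).obj (inducedModule R G M)

instance inducedObj_nonempty : (inducedObj R G).Nonempty :=
  ⟨_, FGModuleCat.of R PUnit, rfl⟩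

variable [StableTriangulation (shortExactRG R G)]

/-- `K`: the thick subcategory of `stmod RG` generated by the induced modules. -/
abbrev thickK : ObjectProperty (StMod R G) := (inducedObj R G).triangEnvelope

/-- `K'`: the full subcategory of the relative stable category on the objects of `K`. -/
def thickK' : ObjectProperty (StBik R G) := fun X =>
  thickK R G ((toStable (shortExactRG R G)).obj X.as)

end GroupAlgebra

/-!
Both exact structures on `mod RG` are Frobenius. Since `G` is finite, the induced module `RG ⊗ M`
is also coinduced (`inducedDesc`, `inducedLift`): maps from it and maps to it are given by
`R`-linear maps from `M` and to `M`. For the `R`-split sequences, all induced modules are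
therefore relatively projective and injective, and every module embeds into, and is a quotient of,
the module induced from its own restriction. For all short exact sequences one uses the modules
induced from `R ^ n`; there are enough of them because an artinian ring which is injective over
itself is a cogenerator (`exists_injective_linearMap_pi`). Happel's theorem, proved here for the
closure properties collected in `IsFrobeniusClass`, then gives the two triangulations
(`IsFrobeniusClass.nonempty_stableTriangulation`). As shifts are indexed by `ℤ`, the cosyzygy
functor, which is only an equivalence, has to be extended to a coherent family of powers
(`exists_hasShift`), and a functor which commutes with the cosyzygies has to be extended likewise
(`exists_commShift`).

The comparison holds for any Frobenius classes `E' ≤ E` and any thick subcategory `K` of the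
stable category of `E` that contains the objects which are projective-injective for `E'`
(`exists_verdierQuotient_equivalence`). Write `K'` for the same objects in the stable category of
`E'`. A map that factors through a projective-injective object of `E'` vanishes in the quotient by
`K`, so the identity on objects induces a functor `ψ` from the stable category of `E'` to that
quotient. A short exact sequence in `E'` is also one in `E`, and both suspensions are computed by
the cosyzygies with respect to `E'`, because their middle terms lie in `K`. Hence `ψ` is
triangulated, `K'` is thick, and `ψ` induces `φ` on the quotient by `K'`.

For the inverse of `φ`, projective-injective objects for `E` are so for `E'`, which gives a
functor from the stable category of `E` to the quotient by `K'`. It inverts every `f : X ⟶ Y` with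
cone in `K` (`fromStable_inverts`): embed `X` into a projective-injective object `I` for `E'`;
then `X ⟶ Y ⊞ I` has a cokernel sequence in `E'`, its third term is the cone of `f` in the stable
category of `E'`, and it lies in `K` because the cone of `f` and `I` do. The two induced functors
are the identity on objects, so that they are mutually inverse by the universal properties of the
quotients. Finally the relatively projective-injective `RG`-modules lie in the thick subcategory
generated by the induced modules, being direct summands of induced modules
(`thickK_of_relProjInj`).
-/

/-! ### Shifts indexed by the integers -/

section IntShift

/-- A family of types indexed by `ℤ` whose consecutive members are linked by a relation that can
be followed in both directions has a linked section through any given point at `0`. -/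
lemma exists_int_section {T : ℤ → Type*} (r : ∀ i, T i → T (i + 1) → Prop)
    (up : ∀ i t, ∃ s, r i t s) (down : ∀ i s, ∃ t, r i t s) (t₀ : T 0) :
    ∃ s : ∀ i, T i, s 0 = t₀ ∧ ∀ i, r i (s i) (s (i + 1)) := by
  choose f hf using up
  choose g hg using down
  let pos : ∀ n : ℕ, T n := fun n => Nat.rec (motive := fun n : ℕ => T n) t₀ (fun n t => f n t) n
  let neg : ∀ n : ℕ, T (Int.negSucc n) := fun n =>
    Nat.rec (motive := fun n : ℕ => T (Int.negSucc n)) (g (Int.negSucc 0) t₀)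
      (fun n t => g (Int.negSucc (n + 1)) t) n
  refine ⟨fun i => Int.rec (motive := fun i => T i) pos neg i, rfl, ?_⟩
  rintro (n | _ | n)
  · exact hf n (pos n)
  · exact hg (Int.negSucc 0) t₀
  · exact hg (Int.negSucc (n + 1)) (neg n)

lemma int_induction_iff {p : ℤ → Prop} (zero : p 0) (step : ∀ i, p i ↔ p (i + 1)) (i : ℤ) :
    p i := by
  induction i with
  | zero => exact zero
  | succ i hi => exact (step _).1 hi
  | pred i hi => exact (step _).2 (by simpa using hi)

variable {C : Type u} [Category.{v} C]

lemma exists_iso_map_app_eq {D E : Type*} [Category D] [Category E] {G H : C ⥤ D} (Φ : D ⥤ E)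
    [Φ.Full] [Φ.Faithful] (γ : G ⋙ Φ ≅ H ⋙ Φ) :
    ∃ α : G ≅ H, ∀ X, Φ.map (α.hom.app X) = γ.hom.app X :=
  ⟨NatIso.ofComponents (fun X => Φ.preimageIso (γ.app X))
    (fun f => Φ.map_injective (by simpa using γ.hom.naturality f)), fun X => by simp⟩

/-- Powers of an autoequivalence: a family of endofunctors `F i`, indexed by the integers, starting
with the identity, with isomorphisms `F (i + 1) ≅ F i ⋙ Φ`. -/
structure IntPowers (Φ : C ⥤ C) where
  /-- the powers -/
  F : ℤ → C ⥤ C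
  /-- the zeroth power is the identity -/
  zero : F 0 ≅ 𝟭 C
  /-- the inductive description of the powers -/
  succ : ∀ i j, i + 1 = j → (F j ≅ F i ⋙ Φ)

lemma exists_intPowers (Φ : C ⥤ C) [Φ.IsEquivalence] : Nonempty (IntPowers Φ) := by
  obtain ⟨F, h0, h⟩ := exists_int_section (T := fun _ => C ⥤ C)
    (fun _ G H => Nonempty (H ≅ G ⋙ Φ)) (fun _ G => ⟨G ⋙ Φ, ⟨Iso.refl _⟩⟩)
    (fun _ H => ⟨H ⋙ Φ.inv, ⟨H.rightUnitor.symm ≪≫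
      Functor.isoWhiskerLeft H Φ.asEquivalence.counitIso.symm ≪≫
        (Functor.associator _ _ _).symm⟩⟩) (𝟭 C)
  exact ⟨⟨F, eqToIso h0, fun i j hij => by subst hij; exact (h i).some⟩⟩

namespace IntPowers

variable {Φ : C ⥤ C} (P : IntPowers Φ)

/-- The compatibility of a family of isomorphisms `F (n + m) ≅ F n ⋙ F m`, at two consecutive
values of `m`, with the inductive description of the powers. -/
def Linked (n m : ℤ) (α : ∀ k, n + m = k → (P.F k ≅ P.F n ⋙ P.F m))
    (β : ∀ k, n + (m + 1) = k → (P.F k ≅ P.F n ⋙ P.F (m + 1))) : Prop :=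
  ∀ (k k' : ℤ) (h : n + m = k) (h' : n + (m + 1) = k') (h'' : k + 1 = k') (X : C),
    (β k' h').hom.app X ≫ (P.succ m (m + 1) rfl).hom.app ((P.F n).obj X) =
      (P.succ k k' h'').hom.app X ≫ Φ.map ((α k h).hom.app X)

lemma exists_add [Φ.IsEquivalence] (n : ℤ) :
    ∃ add : ∀ m k, n + m = k → (P.F k ≅ P.F n ⋙ P.F m),
      (∀ X, (add 0 n (add_zero n)).hom.app X = P.zero.inv.app ((P.F n).obj X)) ∧
      ∀ m, P.Linked n m (add m) (add (m + 1)) := by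
  obtain ⟨s, hs, hs'⟩ := exists_int_section
    (T := fun m => ∀ k, n + m = k → (P.F k ≅ P.F n ⋙ P.F m)) (fun m => P.Linked n m)
    (fun m α => ⟨fun k hk => P.succ (n + m) k (by rw [← hk, add_assoc]) ≪≫
        Functor.isoWhiskerRight (α _ rfl) Φ ≪≫ Functor.associator _ _ _ ≪≫
        Functor.isoWhiskerLeft (P.F n) (P.succ m (m + 1) rfl).symm, by
          rintro k k' h h' h'' X
          subst h
          simp⟩)
    (fun m β => by
      choose α hα using fun k (hk : n + m = k) => exists_iso_map_app_eq Φ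
        ((P.succ k (k + 1) rfl).symm ≪≫ β (k + 1) (by rw [← hk, add_assoc]) ≪≫
          Functor.isoWhiskerLeft (P.F n) (P.succ m (m + 1) rfl) ≪≫
          (Functor.associator _ _ _).symm)
      refine ⟨α, ?_⟩
      rintro k _ h h' rfl X
      rw [hα]
      simp)
    (fun k hk => eqToIso (by rw [← hk, add_zero]) ≪≫ (P.F n).rightUnitor.symm ≪≫
      Functor.isoWhiskerLeft (P.F n) P.zero.symm)
  refine ⟨s, fun X => ?_, hs'⟩
  rw [hs]
  simp

variable [Φ.IsEquivalence]

/-- The isomorphism `F k ≅ F n ⋙ F m` for `n + m = k`. -/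
noncomputable def add (n m k : ℤ) (h : n + m = k) : P.F k ≅ P.F n ⋙ P.F m :=
  (P.exists_add n).choose m k h

lemma add_zero (n : ℤ) (X : C) :
    (P.add n 0 n (_root_.add_zero n)).hom.app X = P.zero.inv.app ((P.F n).obj X) :=
  (P.exists_add n).choose_spec.1 X

lemma add_succ (n m m' k k' : ℤ) (h : n + m = k) (h' : n + m' = k') (hm : m + 1 = m')
    (hk : k + 1 = k') (X : C) :
    (P.add n m' k' h').hom.app X ≫ (P.succ m m' hm).hom.app ((P.F n).obj X) =
      (P.succ k k' hk).hom.app X ≫ Φ.map ((P.add n m k h).hom.app X) := by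
  subst hm
  exact (P.exists_add n).choose_spec.2 m k k' h h' hk X

lemma add_succ_assoc (n m m' k k' : ℤ) (h : n + m = k) (h' : n + m' = k') (hm : m + 1 = m')
    (hk : k + 1 = k') (X : C) {Z : C} (f : Φ.obj ((P.F m).obj ((P.F n).obj X)) ⟶ Z) :
    (P.add n m' k' h').hom.app X ≫ (P.succ m m' hm).hom.app ((P.F n).obj X) ≫ f =
      (P.succ k k' hk).hom.app X ≫ Φ.map ((P.add n m k h).hom.app X) ≫ f := by
  have := P.add_succ n m m' k k' h h' hm hk X =≫ f
  simpa only [Category.assoc] using this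

lemma zero_add (n : ℤ) (X : C) :
    (P.add 0 n n (_root_.zero_add n)).hom.app X = (P.F n).map (P.zero.inv.app X) := by
  revert X
  refine int_induction_iff (p := fun n => ∀ X, (P.add 0 n n (_root_.zero_add n)).hom.app X =
    (P.F n).map (P.zero.inv.app X)) ?_ ?_ n
  · intro X
    rw [P.add_zero, ← cancel_epi (P.zero.inv.app X)]
    exact P.zero.inv.naturality (P.zero.inv.app X)
  · intro i
    refine forall_congr' fun X => ?_
    rw [← cancel_mono ((P.succ i (i + 1) rfl).hom.app ((P.F 0).obj X)),
      P.add_succ 0 i (i + 1) i (i + 1) (_root_.zero_add _) (_root_.zero_add _) rfl rfl X,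
      (P.succ i (i + 1) rfl).hom.naturality (P.zero.inv.app X)]
    dsimp
    rw [cancel_epi]
    exact Φ.map_injective.eq_iff.symm

lemma add_assoc (a b c ab bc abc : ℤ) (hab : a + b = ab) (hbc : b + c = bc) (h : ab + c = abc)
    (h' : a + bc = abc) (X : C) :
    (P.add ab c abc h).hom.app X ≫ (P.F c).map ((P.add a b ab hab).hom.app X) =
      (P.add a bc abc h').hom.app X ≫ (P.add b c bc hbc).hom.app ((P.F a).obj X) := by
  revert bc abc X
  refine int_induction_iff (p := fun c => ∀ bc abc (hbc : b + c = bc) (h : ab + c = abc)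
    (h' : a + bc = abc) (X : C),
    (P.add ab c abc h).hom.app X ≫ (P.F c).map ((P.add a b ab hab).hom.app X) =
      (P.add a bc abc h').hom.app X ≫ (P.add b c bc hbc).hom.app ((P.F a).obj X)) ?_ ?_ c
  · intro bc abc hbc h h' X
    obtain rfl : b = bc := by lia
    obtain rfl : ab = abc := by lia
    rw [P.add_zero, P.add_zero]
    exact (P.zero.inv.naturality ((P.add a b ab hab).hom.app X)).symm
  · intro c
    have key (bc abc : ℤ) (hbc : b + c = bc) (h : ab + c = abc) (h' : a + bc = abc) (X : C) :
        (P.add ab c abc h).hom.app X ≫ (P.F c).map ((P.add a b ab hab).hom.app X) =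
            (P.add a bc abc h').hom.app X ≫ (P.add b c bc hbc).hom.app ((P.F a).obj X) ↔
          (P.add ab (c + 1) (abc + 1) (by lia)).hom.app X ≫
              (P.F (c + 1)).map ((P.add a b ab hab).hom.app X) =
            (P.add a (bc + 1) (abc + 1) (by lia)).hom.app X ≫
              (P.add b (c + 1) (bc + 1) (by lia)).hom.app ((P.F a).obj X) := by
      rw [← cancel_mono ((P.succ c (c + 1) rfl).hom.app ((P.F b).obj ((P.F a).obj X)))]
      have h1 := (P.succ c (c + 1) rfl).hom.naturality ((P.add a b ab hab).hom.app X)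
      dsimp at h1
      simp only [Functor.comp_obj, Category.assoc] at h1 ⊢
      rw [h1, P.add_succ_assoc ab c (c + 1) abc (abc + 1) h (by lia) rfl rfl,
        P.add_succ b c (c + 1) bc (bc + 1) hbc (by lia) rfl rfl,
        P.add_succ_assoc a bc (bc + 1) abc (abc + 1) h' (by lia) rfl rfl,
        cancel_epi, ← Φ.map_comp, ← Φ.map_comp]
      exact Φ.map_injective.eq_iff.symm
    constructor
    · intro H bc abc hbc h h' X
      obtain ⟨bc, rfl⟩ : ∃ i, bc = i + 1 := ⟨bc - 1, by lia⟩
      obtain ⟨abc, rfl⟩ : ∃ i, abc = i + 1 := ⟨abc - 1, by lia⟩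
      exact (key bc abc (by lia) (by lia) (by lia) X).1 (H _ _ _ _ _ X)
    · intro H bc abc hbc h h' X
      exact (key bc abc hbc h h' X).2 (H _ _ _ _ _ X)

lemma eqToHom_comp_add (n m k k' : ℤ) (h : n + m = k) (h' : n + m = k') (X : C) :
    (P.add n m k h).hom.app X =
      eqToHom (by rw [← h, ← h']) ≫ (P.add n m k' h').hom.app X := by
  subst h h'
  simp

/-- The shift by the integers given by the powers of an autoequivalence. -/
noncomputable def shiftMkCore : ShiftMkCore C ℤ where
  F := P.F
  zero := P.zero
  add n m := P.add n m _ rfl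
  assoc_hom_app a b c X := by
    rw [P.add_assoc a b c _ _ _ rfl rfl rfl (_root_.add_assoc _ _ _).symm,
      P.eqToHom_comp_add a (b + c) (a + b + c) (a + (b + c)) (_root_.add_assoc _ _ _).symm rfl,
      Category.assoc]
  zero_add_hom_app n X := by
    rw [P.eqToHom_comp_add 0 n (0 + n) n rfl (_root_.zero_add _), P.zero_add]
  add_zero_hom_app n X := by
    rw [P.eqToHom_comp_add n 0 (n + 0) n rfl (_root_.add_zero _), P.add_zero]

end IntPowers

/-- Every autoequivalence is, up to isomorphism, the shift by `1` of a shift by the integers. -/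
lemma exists_hasShift (Φ : C ⥤ C) [Φ.IsEquivalence] :
    ∃ _ : HasShift C ℤ, Nonempty (Φ ≅ shiftFunctor C (1 : ℤ)) := by
  obtain ⟨P⟩ := exists_intPowers Φ
  exact ⟨hasShiftMk C ℤ P.shiftMkCore, ⟨((P.succ 0 1 (by lia)) ≪≫
    Functor.isoWhiskerRight P.zero Φ ≪≫ Φ.leftUnitor).symm⟩⟩

lemma shiftFunctor_additive_of_one [Preadditive C] [HasShift C ℤ]
    [(shiftFunctor C (1 : ℤ)).Additive] (n : ℤ) : (shiftFunctor C n).Additive := by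
  refine int_induction_iff (p := fun n => (shiftFunctor C n).Additive) ?_ (fun i => ?_) n
  · exact Functor.additive_of_iso (shiftFunctorZero C ℤ).symm
  · constructor
    · intro h
      exact Functor.additive_of_iso (shiftFunctorAdd C i 1).symm
    · intro h
      have : (shiftFunctor C i ⋙ shiftFunctor C (1 : ℤ)).Additive :=
        Functor.additive_of_iso (shiftFunctorAdd C i 1)
      exact Functor.additive_of_comp_faithful _ (shiftFunctor C (1 : ℤ))

variable {D : Type*} [Category D] [HasShift C ℤ] [HasShift D ℤ] (F : C ⥤ D)
  (e : shiftFunctor C (1 : ℤ) ⋙ F ≅ F ⋙ shiftFunctor D (1 : ℤ))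

open Functor.CommShift in
lemma isoAdd'_one_bijective {i j : ℤ} (h : i + 1 = j) :
    Function.Bijective (fun α : shiftFunctor C i ⋙ F ≅ F ⋙ shiftFunctor D i => isoAdd' h α e) := by
  constructor
  · intro α β hαβ
    ext X
    have := NatTrans.congr_app (congr_arg Iso.hom hαβ) X
    simp only [isoAdd'_hom_app] at this
    rw [cancel_epi, cancel_epi, cancel_mono] at this
    exact (shiftFunctor D (1 : ℤ)).map_injective this
  · intro β
    obtain ⟨α, hα⟩ := exists_iso_map_app_eq (shiftFunctor D (1 : ℤ))
      (G := shiftFunctor C i ⋙ F) (H := F ⋙ shiftFunctor D i)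
      (Functor.associator _ _ _ ≪≫ Functor.isoWhiskerLeft _ e.symm ≪≫
        (Functor.associator _ _ _).symm ≪≫
        Functor.isoWhiskerRight (shiftFunctorAdd' C i 1 j h).symm F ≪≫ β ≪≫
        Functor.isoWhiskerLeft F (shiftFunctorAdd' D i 1 j h) ≪≫ (Functor.associator _ _ _).symm)
    refine ⟨α, ?_⟩
    ext X
    rw [isoAdd'_hom_app, hα]
    simp [← Functor.map_comp_assoc]

open Functor.CommShift in
/-- A functor between categories with a shift by `ℤ` commutes with the shift as soon as it is
equipped with an isomorphism for the shift by `1`. -/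
lemma exists_commShift : ∃ c : F.CommShift ℤ, c.commShiftIso 1 = e := by
  obtain ⟨s, hs, hs'⟩ := exists_int_section
    (T := fun i => shiftFunctor C i ⋙ F ≅ F ⋙ shiftFunctor D i)
    (fun i α β => isoAdd' rfl α e = β) (fun i α => ⟨_, rfl⟩)
    (fun i β => (isoAdd'_one_bijective F e rfl).2 β) (isoZero F ℤ)
  have h1 : ∀ i j (h : i + 1 = j), s j = isoAdd' h (s i) e := by
    rintro i j rfl
    exact (hs' i).symm
  have key (a b : ℤ) : ∀ c (h : a + b = c), s c = isoAdd' h (s a) (s b) := by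
    refine int_induction_iff (p := fun b => ∀ c (h : a + b = c), s c = isoAdd' h (s a) (s b))
      ?_ (fun b => ?_) b
    · rintro c h
      obtain rfl : a = c := by simpa using h
      rw [hs, isoAdd'_isoZero]
    · have (c : ℤ) (h : a + b = c) : isoAdd' (show a + (b + 1) = c + 1 by lia) (s a) (s (b + 1)) =
          isoAdd' rfl (isoAdd' h (s a) (s b)) e := by
        rw [h1 b _ rfl, isoAdd'_assoc (hab := h) (hbc := rfl)]
        lia
      constructor
      · intro H c h
        obtain rfl : a + b + 1 = c := by lia
        rw [this _ rfl, ← H _ rfl]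
        exact h1 _ _ rfl
      · intro H c h
        apply (isoAdd'_one_bijective F e (rfl : c + 1 = c + 1)).1
        dsimp only
        rw [← this c h, ← H, ← h1]
  refine ⟨⟨s, hs, fun a b => key a b _ rfl⟩, ?_⟩
  change s 1 = e
  rw [h1 0 1 rfl, hs, isoZero_isoAdd'_]

end IntShift

/-! ### The suspension of a Frobenius category -/

section Frobenius

variable {A : Type u'} [Category.{v'} A] [Preadditive A] [HasZeroObject A] [HasBinaryBiproducts A]

/-- A class `E` of short exact sequences which makes `A` a Frobenius category: its members are
kernel-cokernel pairs, there are enough projective-injective objects on both sides, and the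
members of `E` can be pushed out, pulled back and composed. The closure properties are stated in
the form in which the triangulation of the stable category uses them. -/
structure IsFrobeniusClass (E : ObjectProperty (ShortComplex A)) : Prop where
  mono {S : ShortComplex A} (hS : E S) : Mono S.f
  epi {S : ShortComplex A} (hS : E S) : Epi S.g
  lift {S : ShortComplex A} (hS : E S) {W : A} (a : W ⟶ S.X₂) (ha : a ≫ S.g = 0) :
    ∃ b, b ≫ S.f = a
  desc {S : ShortComplex A} (hS : E S) {W : A} (a : S.X₂ ⟶ W) (ha : S.f ≫ a = 0) :
    ∃ b, S.g ≫ b = a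
  id_mem (X : A) : E (ShortComplex.mk (𝟙 X) (0 : X ⟶ 0) comp_zero)
  exists_injective (X : A) : ∃ (I C : A) (i : X ⟶ I) (p : I ⟶ C) (w : i ≫ p = 0),
    E (ShortComplex.mk i p w) ∧ RelProjInj E I
  exists_projective (X : A) : ∃ (P K : A) (k : K ⟶ P) (p : P ⟶ X) (w : k ≫ p = 0),
    E (ShortComplex.mk k p w) ∧ RelProjInj E P
  /-- the pushout of an admissible monomorphism along any map, as a short exact sequence -/
  cone {S : ShortComplex A} (hS : E S) {Y : A} (f : S.X₁ ⟶ Y) :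
    ∃ (Z : A) (q : Y ⊞ S.X₂ ⟶ Z) (w : biprod.lift f S.f ≫ q = 0),
      E (ShortComplex.mk (biprod.lift f S.f) q w)
  /-- a map of short exact sequences `X ⟶ Y ⟶ Z` and `X ⟶ I ⟶ C` which is the identity
  on `X` makes its right square bicartesian -/
  bicart_right {X Y Z I C : A} {f : X ⟶ Y} {g : Y ⟶ Z} {w : f ≫ g = 0} {i : X ⟶ I} {p : I ⟶ C}
    {w' : i ≫ p = 0} (hS : E (ShortComplex.mk f g w)) (hS' : E (ShortComplex.mk i p w'))
    (h : Y ⟶ I) (k : Z ⟶ C) (hf : f ≫ h = i) (hg : g ≫ k = h ≫ p) :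
    E (ShortComplex.mk (biprod.lift g h) (biprod.desc k (-p)) (by simp [hg]))
  /-- a map of short exact sequences `K ⟶ P ⟶ C` and `A ⟶ B ⟶ C` which is the identity
  on `C` makes its left square bicartesian -/
  bicart_left {X Y C K P : A} {a : X ⟶ Y} {b : Y ⟶ C} {w : a ≫ b = 0} {k : K ⟶ P} {p : P ⟶ C}
    {w' : k ≫ p = 0} (hS : E (ShortComplex.mk a b w)) (hS' : E (ShortComplex.mk k p w'))
    (s : P ⟶ Y) (h : K ⟶ X) (hs : s ≫ b = p) (hk : h ≫ a = k ≫ s) :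
    E (ShortComplex.mk (biprod.lift (-h) k) (biprod.desc a s) (by simp [hk]))
  /-- the third isomorphism theorem -/
  comp {X Y Z U V : A} {f : X ⟶ Y} {g : Y ⟶ U} {w : f ≫ g = 0} {f' : Y ⟶ Z} {g' : Z ⟶ V}
    {w' : f' ≫ g' = 0} (hS : E (ShortComplex.mk f g w)) (hS' : E (ShortComplex.mk f' g' w')) :
    ∃ (W : A) (q : Z ⟶ W) (m : U ⟶ W) (n : W ⟶ V) (wq : (f ≫ f') ≫ q = 0) (wm : m ≫ n = 0),
      E (ShortComplex.mk (f ≫ f') q wq) ∧ E (ShortComplex.mk m n wm) ∧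
        g ≫ m = f' ≫ q ∧ q ≫ n = g'

variable {E : ObjectProperty (ShortComplex A)}

lemma toStable_map_eq_iff {X Y : A} (f g : X ⟶ Y) :
    (toStable E).map f = (toStable E).map g ↔
      ∃ (I : A) (_ : RelProjInj E I) (a : X ⟶ I) (b : I ⟶ Y), f - g = a ≫ b :=
  Quotient.functor_map_eq_iff (stableRel E) f g

lemma toStable_isZero {X : A} (hX : RelProjInj E X) : IsZero ((toStable E).obj X) := by
  rw [IsZero.iff_id_eq_zero, ← (toStable E).map_id, ← Functor.map_zero, toStable_map_eq_iff]
  exact ⟨X, hX, 𝟙 X, 𝟙 X, by simp⟩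

lemma exists_hom_of_relInjective (hE : IsFrobeniusClass E) {S S' : ShortComplex A} (hS : E S)
    (hS' : RelInjective E S'.X₂) (a : S.X₁ ⟶ S'.X₁) : ∃ φ : S ⟶ S', φ.τ₁ = a := by
  obtain ⟨b, hb⟩ := hS' S hS (a ≫ S'.f)
  obtain ⟨c, hc⟩ := hE.desc hS (b ≫ S'.g) (by rw [reassoc_of% hb, S'.zero, comp_zero])
  exact ⟨⟨a, b, c, hb.symm, hc.symm⟩, rfl⟩

lemma exists_hom_of_relProjective (hE : IsFrobeniusClass E) {S S' : ShortComplex A}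
    (hS' : E S') (hS : RelProjective E S.X₂) (c : S.X₃ ⟶ S'.X₃) : ∃ φ : S ⟶ S', φ.τ₃ = c := by
  obtain ⟨b, hb⟩ := hS S' hS' (S.g ≫ c)
  obtain ⟨a, ha⟩ := hE.lift hS' (S.f ≫ b) (by rw [Category.assoc, hb, S.zero_assoc, zero_comp])
  exact ⟨⟨a, b, c, ha, hb⟩, rfl⟩

/-- A map of short exact sequences into a sequence with projective-injective middle term is
determined in the stable category, on the third terms, by its first component. -/
lemma toStable_map_τ₃_eq (hE : IsFrobeniusClass E) {S S' : ShortComplex A} (hS : E S)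
    (hS' : RelProjInj E S'.X₂) (φ ψ : S ⟶ S')
    (h : (toStable E).map φ.τ₁ = (toStable E).map ψ.τ₁) :
    (toStable E).map φ.τ₃ = (toStable E).map ψ.τ₃ := by
  rw [toStable_map_eq_iff] at h
  obtain ⟨I, hI, a, b, hab⟩ := h
  obtain ⟨c, hc⟩ := hI.2 S hS a
  obtain ⟨d, hd⟩ := hE.desc hS (φ.τ₂ - ψ.τ₂ - c ≫ b ≫ S'.f) (by
    rw [Preadditive.comp_sub, Preadditive.comp_sub, ← φ.comm₁₂, ← ψ.comm₁₂, reassoc_of% hc,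
      ← reassoc_of% hab, Preadditive.sub_comp, sub_self])
  rw [toStable_map_eq_iff]
  refine ⟨S'.X₂, hS', d, S'.g, ?_⟩
  have := hE.epi hS
  rw [← cancel_epi S.g, reassoc_of% hd]
  simp [← φ.comm₂₃, ← ψ.comm₂₃]

/-- A map of short exact sequences with projective-injective middle terms is determined in the
stable category, on the first terms, by its third component. -/
lemma toStable_map_τ₁_eq (hE : IsFrobeniusClass E) {S S' : ShortComplex A} (hS' : E S')
    (hS : RelProjInj E S.X₂) (φ ψ : S ⟶ S')
    (h : (toStable E).map φ.τ₃ = (toStable E).map ψ.τ₃) :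
    (toStable E).map φ.τ₁ = (toStable E).map ψ.τ₁ := by
  rw [toStable_map_eq_iff] at h
  obtain ⟨I, hI, a, b, hab⟩ := h
  obtain ⟨c, hc⟩ := hI.1 S' hS' b
  obtain ⟨d, hd⟩ := hE.lift hS' (φ.τ₂ - ψ.τ₂ - S.g ≫ a ≫ c) (by
    simp only [Preadditive.sub_comp, φ.comm₂₃, ψ.comm₂₃, Category.assoc, hc]
    rw [← hab, Preadditive.comp_sub, sub_self])
  rw [toStable_map_eq_iff]
  refine ⟨S.X₂, hS, S.f, d, ?_⟩
  have := hE.mono hS'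
  rw [← cancel_mono S'.f, Category.assoc, hd]
  simp [φ.comm₁₂, ψ.comm₁₂]

lemma isIso_toStable_map_τ₃ (hE : IsFrobeniusClass E) {S S' : ShortComplex A} (hS : E S)
    (hS' : E S') (h : RelProjInj E S.X₂) (h' : RelProjInj E S'.X₂) (φ : S ⟶ S')
    [IsIso ((toStable E).map φ.τ₁)] : IsIso ((toStable E).map φ.τ₃) := by
  obtain ⟨a, ha⟩ := (toStable E).map_surjective (inv ((toStable E).map φ.τ₁))
  obtain ⟨ψ, rfl⟩ := exists_hom_of_relInjective hE hS' h.2 a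
  refine ⟨(toStable E).map ψ.τ₃, ?_, ?_⟩
  · rw [← Functor.map_comp, ← ShortComplex.comp_τ₃,
      toStable_map_τ₃_eq hE hS h (φ ≫ ψ) (𝟙 S) (by simp [ha])]
    simp
  · rw [← Functor.map_comp, ← ShortComplex.comp_τ₃,
      toStable_map_τ₃_eq hE hS' h' (ψ ≫ φ) (𝟙 S') (by simp [ha])]
    simp

namespace IsFrobeniusClass

variable (hE : IsFrobeniusClass E)
include hE

/-- A chosen short exact sequence from `X` to its cosyzygy, with projective-injective middle
term. -/
noncomputable abbrev cosyzygySeq (X : A) : ShortComplex A :=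
  ⟨(hE.exists_injective X).choose_spec.choose_spec.choose,
    (hE.exists_injective X).choose_spec.choose_spec.choose_spec.choose,
    (hE.exists_injective X).choose_spec.choose_spec.choose_spec.choose_spec.choose⟩

lemma cosyzygySeq_mem (X : A) : E (hE.cosyzygySeq X) :=
  (hE.exists_injective X).choose_spec.choose_spec.choose_spec.choose_spec.choose_spec.1

lemma cosyzygySeq_projInj (X : A) : RelProjInj E (hE.cosyzygySeq X).X₂ :=
  (hE.exists_injective X).choose_spec.choose_spec.choose_spec.choose_spec.choose_spec.2

/-- A map from a short exact sequence to the cosyzygy sequence of `Y`, extending a map to `Y`. -/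
noncomputable def toCosyzygySeq {S : ShortComplex A} (hS : E S) {Y : A} (f : S.X₁ ⟶ Y) :
    S ⟶ hE.cosyzygySeq Y :=
  (exists_hom_of_relInjective hE (S' := hE.cosyzygySeq Y) hS (hE.cosyzygySeq_projInj Y).2 f).choose

@[simp]
lemma toCosyzygySeq_τ₁ {S : ShortComplex A} (hS : E S) {Y : A} (f : S.X₁ ⟶ Y) :
    (hE.toCosyzygySeq hS f).τ₁ = f :=
  (exists_hom_of_relInjective hE (S' := hE.cosyzygySeq Y) hS
    (hE.cosyzygySeq_projInj Y).2 f).choose_spec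

lemma map_τ₃_eq_toCosyzygySeq {S : ShortComplex A} (hS : E S) {Y : A} (f : S.X₁ ⟶ Y)
    (φ : S ⟶ hE.cosyzygySeq Y) (h : (toStable E).map φ.τ₁ = (toStable E).map f) :
    (toStable E).map φ.τ₃ = (toStable E).map (hE.toCosyzygySeq hS f).τ₃ :=
  toStable_map_τ₃_eq hE hS (hE.cosyzygySeq_projInj Y) _ _
    (by rw [h, toCosyzygySeq_τ₁])

/-- The suspension functor of the stable category: the cosyzygy. -/
noncomputable def susp : StableCat E ⥤ StableCat E :=
  CategoryTheory.Quotient.lift _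
    { obj := fun X => (toStable E).obj (hE.cosyzygySeq X).X₃
      map := fun f => (toStable E).map (hE.toCosyzygySeq (hE.cosyzygySeq_mem _) f).τ₃
      map_id := fun X => by
        rw [← hE.map_τ₃_eq_toCosyzygySeq (hE.cosyzygySeq_mem X) (𝟙 X) (𝟙 _) rfl]
        simp
      map_comp := fun {X Y Z} f g => by
        rw [← hE.map_τ₃_eq_toCosyzygySeq (hE.cosyzygySeq_mem X) (f ≫ g)
          (hE.toCosyzygySeq (hE.cosyzygySeq_mem X) f ≫
            hE.toCosyzygySeq (hE.cosyzygySeq_mem Y) g) (by simp)]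
        simp }
    (fun X Y f g h => hE.map_τ₃_eq_toCosyzygySeq _ _ _ (by
      rw [toCosyzygySeq_τ₁]
      exact CategoryTheory.Quotient.sound _ h))

lemma susp_map_toStable_map {X Y : A} (f : X ⟶ Y) (φ : hE.cosyzygySeq X ⟶ hE.cosyzygySeq Y)
    (h : (toStable E).map φ.τ₁ = (toStable E).map f) :
    hE.susp.map ((toStable E).map f) = (toStable E).map φ.τ₃ :=
  (hE.map_τ₃_eq_toCosyzygySeq (hE.cosyzygySeq_mem X) f φ h).symm

lemma susp_additive : hE.susp.Additive where
  map_add {X Y f g} := by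
    obtain ⟨f, rfl⟩ := (toStable E).map_surjective (X := X.as) (Y := Y.as) f
    obtain ⟨g, rfl⟩ := (toStable E).map_surjective (X := X.as) (Y := Y.as) g
    let φ := hE.toCosyzygySeq (hE.cosyzygySeq_mem X.as) f
    let ψ := hE.toCosyzygySeq (hE.cosyzygySeq_mem X.as) g
    rw [← Functor.map_add, hE.susp_map_toStable_map (f + g) (φ + ψ) (by simp [φ, ψ]),
      hE.susp_map_toStable_map f φ (by simp [φ]), hE.susp_map_toStable_map g ψ (by simp [ψ]),
      ShortComplex.add_τ₃, Functor.map_add]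
    rfl

lemma susp_faithful : hE.susp.Faithful where
  map_injective {X Y f g} h := by
    obtain ⟨f, rfl⟩ := (toStable E).map_surjective (X := X.as) (Y := Y.as) f
    obtain ⟨g, rfl⟩ := (toStable E).map_surjective (X := X.as) (Y := Y.as) g
    let φ := hE.toCosyzygySeq (hE.cosyzygySeq_mem X.as) f
    let ψ := hE.toCosyzygySeq (hE.cosyzygySeq_mem X.as) g
    have := toStable_map_τ₁_eq hE (hE.cosyzygySeq_mem Y.as) (hE.cosyzygySeq_projInj X.as) φ ψ h
    simpa [φ, ψ] using this

lemma susp_full : hE.susp.Full where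
  map_surjective {X Y} f := by
    obtain ⟨f, rfl⟩ := (toStable E).map_surjective (X := (hE.cosyzygySeq X.as).X₃)
      (Y := (hE.cosyzygySeq Y.as).X₃) f
    obtain ⟨φ, rfl⟩ := exists_hom_of_relProjective hE (S := hE.cosyzygySeq X.as)
      (hE.cosyzygySeq_mem Y.as) (hE.cosyzygySeq_projInj X.as).1 f
    exact ⟨(toStable E).map φ.τ₁, hE.susp_map_toStable_map φ.τ₁ φ rfl⟩

/-- The connecting map of a short exact sequence, with values in the chosen cosyzygy. -/
noncomputable def connecting {S : ShortComplex A} (hS : E S) :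
    (toStable E).obj S.X₃ ⟶ hE.susp.obj ((toStable E).obj S.X₁) :=
  (toStable E).map (hE.toCosyzygySeq hS (𝟙 S.X₁)).τ₃

lemma connecting_naturality {S S' : ShortComplex A} (hS : E S) (hS' : E S') (φ : S ⟶ S') :
    (toStable E).map φ.τ₃ ≫ hE.connecting hS' =
      hE.connecting hS ≫ hE.susp.map ((toStable E).map φ.τ₁) := by
  rw [hE.susp_map_toStable_map φ.τ₁ (hE.toCosyzygySeq (hE.cosyzygySeq_mem _) φ.τ₁) (by simp)]
  exact toStable_map_τ₃_eq hE hS (hE.cosyzygySeq_projInj _) (φ ≫ hE.toCosyzygySeq hS' (𝟙 _))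
    (hE.toCosyzygySeq hS (𝟙 _) ≫ hE.toCosyzygySeq (hE.cosyzygySeq_mem _) φ.τ₁) (by simp)

lemma isIso_connecting {S : ShortComplex A} (hS : E S) (h : RelProjInj E S.X₂) :
    IsIso (hE.connecting hS) := by
  have : IsIso ((toStable E).map (hE.toCosyzygySeq hS (𝟙 S.X₁)).τ₁) := by
    rw [toCosyzygySeq_τ₁, (toStable E).map_id]
    infer_instance
  exact isIso_toStable_map_τ₃ hE hS (hE.cosyzygySeq_mem _) h (hE.cosyzygySeq_projInj _) _

lemma susp_isEquivalence : hE.susp.IsEquivalence where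
  faithful := hE.susp_faithful
  full := hE.susp_full
  essSurj := ⟨fun X => by
    obtain ⟨P, K, k, p, w, hS, hP⟩ := hE.exists_projective X.as
    have := hE.isIso_connecting hS hP
    exact ⟨(toStable E).obj K, ⟨(asIso (hE.connecting hS)).symm⟩⟩⟩

end IsFrobeniusClass

end Frobenius

/-! ### The triangulation of the stable category -/

section Triangulation

variable {A : Type u'} [Category.{v'} A] [Preadditive A] [HasZeroObject A] [HasBinaryBiproducts A]
  {E : ObjectProperty (ShortComplex A)}

/-- Adding a projective-injective summand does not change an object of the stable category. -/
noncomputable def toStableBiprodIso (Y : A) {I : A} (hI : RelProjInj E I) :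
    (toStable E).obj Y ≅ (toStable E).obj (Y ⊞ I) where
  hom := (toStable E).map biprod.inl
  inv := (toStable E).map biprod.fst
  hom_inv_id := by rw [← Functor.map_comp, biprod.inl_fst, (toStable E).map_id]
  inv_hom_id := by
    rw [← Functor.map_comp, ← (toStable E).map_id, toStable_map_eq_iff]
    refine ⟨I, hI, -biprod.snd, biprod.inr, ?_⟩
    rw [Preadditive.neg_comp, ← biprod.total]
    abel

lemma toStable_map_comp_biprodIso_hom {X Y I : A} (hI : RelProjInj E I) (f : X ⟶ Y)
    (f' : X ⟶ Y ⊞ I) (h : f' ≫ biprod.fst = f) :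
    (toStable E).map f ≫ (toStableBiprodIso Y hI).hom = (toStable E).map f' := by
  rw [← cancel_mono (toStableBiprodIso Y hI).inv, Category.assoc, Iso.hom_inv_id,
    Category.comp_id, ← h, Functor.map_comp]
  rfl

omit [Preadditive A] [HasZeroObject A] [HasBinaryBiproducts A] in
/-- The completion of morphisms of triangles can be checked up to isomorphism of triangles. -/
lemma exists_completion_of_iso [HasShift A ℤ] {T T' U U' : Triangle A} (e : T ≅ U) (e' : T' ≅ U')
    (H : ∀ (a : U.obj₁ ⟶ U'.obj₁) (b : U.obj₂ ⟶ U'.obj₂), U.mor₁ ≫ b = a ≫ U'.mor₁ →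
      ∃ ψ : U ⟶ U', ψ.hom₁ = a ∧ ψ.hom₂ = b)
    (a : T.obj₁ ⟶ T'.obj₁) (b : T.obj₂ ⟶ T'.obj₂) (h : T.mor₁ ≫ b = a ≫ T'.mor₁) :
    ∃ c : T.obj₃ ⟶ T'.obj₃, T.mor₂ ≫ c = b ≫ T'.mor₂ ∧ T.mor₃ ≫ a⟦1⟧' = c ≫ T'.mor₃ := by
  obtain ⟨ψ, h₁, h₂⟩ := H (e.inv.hom₁ ≫ a ≫ e'.hom.hom₁) (e.inv.hom₂ ≫ b ≫ e'.hom.hom₂) (by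
    rw [Category.assoc, Category.assoc, ← e'.hom.comm₁, e.inv.comm₁_assoc, reassoc_of% h])
  let χ : T ⟶ T' := e.hom ≫ ψ ≫ e'.inv
  have hχ₁ : χ.hom₁ = a := by simp [χ, h₁]
  have hχ₂ : χ.hom₂ = b := by simp [χ, h₂]
  refine ⟨χ.hom₃, ?_, ?_⟩
  · rw [χ.comm₂, hχ₂]
  · rw [← χ.comm₃, hχ₁]

variable (E) [HasShift (StableCat E) ℤ]

/-- Connecting maps for the short exact sequences in `E`, with values in a given shift of the
stable category: they are natural, and invertible when the middle term is
projective-injective. -/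
structure ConnectingMaps where
  /-- the connecting map -/
  δ : ∀ S : ShortComplex A, E S →
    ((toStable E).obj S.X₃ ⟶ ((toStable E).obj S.X₁)⟦(1 : ℤ)⟧)
  naturality : ∀ (S S' : ShortComplex A) (hS : E S) (hS' : E S') (φ : S ⟶ S'),
    (toStable E).map φ.τ₃ ≫ δ S' hS' = δ S hS ≫ ((toStable E).map φ.τ₁)⟦(1 : ℤ)⟧'
  isIso : ∀ (S : ShortComplex A) (hS : E S), RelProjInj E S.X₂ → IsIso (δ S hS)

namespace ConnectingMaps

variable {E} (d : ConnectingMaps E)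

/-- The triangle of a short exact sequence. -/
abbrev triangle (S : ShortComplex A) (hS : E S) : Triangle (StableCat E) :=
  Triangle.mk ((toStable E).map S.f) ((toStable E).map S.g) (d.δ S hS)

/-- The triangles isomorphic to the triangle of a short exact sequence. -/
def distinguished : Set (Triangle (StableCat E)) :=
  {T | ∃ (S : ShortComplex A) (hS : E S), Nonempty (T ≅ d.triangle S hS)}

omit [HasZeroObject A] [HasBinaryBiproducts A] in
lemma mem_of_iso {T T' : Triangle (StableCat E)} (e : T' ≅ T) (h : T ∈ d.distinguished) :
    T' ∈ d.distinguished := by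
  obtain ⟨S, hS, ⟨e'⟩⟩ := h
  exact ⟨S, hS, ⟨e ≪≫ e'⟩⟩

omit [HasZeroObject A] [HasBinaryBiproducts A] in
lemma triangle_mem (S : ShortComplex A) (hS : E S) : d.triangle S hS ∈ d.distinguished :=
  ⟨S, hS, ⟨Iso.refl _⟩⟩

/-- The morphism of triangles given by a map of short exact sequences. -/
@[simps!]
def triangleMap {S S' : ShortComplex A} (hS : E S) (hS' : E S') (φ : S ⟶ S') :
    d.triangle S hS ⟶ d.triangle S' hS' :=
  Triangle.homMk _ _ ((toStable E).map φ.τ₁) ((toStable E).map φ.τ₂) ((toStable E).map φ.τ₃)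
    (((toStable E).map_comp _ _).symm.trans
      ((congrArg (toStable E).map φ.comm₁₂).symm.trans ((toStable E).map_comp _ _)))
    (((toStable E).map_comp _ _).symm.trans
      ((congrArg (toStable E).map φ.comm₂₃).symm.trans ((toStable E).map_comp _ _)))
    (d.naturality S S' hS hS' φ).symm

lemma contractible_mem (hE : IsFrobeniusClass E) (X : StableCat E) :
    contractibleTriangle X ∈ d.distinguished := by
  refine ⟨_, hE.id_mem X.as, ⟨?_⟩⟩
  have h0 : IsZero ((toStable E).obj (0 : A)) := (toStable E).map_isZero (isZero_zero A)
  refine Triangle.isoMk _ _ (Iso.refl _) (Iso.refl _) ((isZero_zero _).iso h0) ?_ ?_ ?_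
  · change 𝟙 _ ≫ 𝟙 _ = 𝟙 _ ≫ (toStable E).map (𝟙 X.as)
    rw [(toStable E).map_id]
  · exact h0.eq_of_tgt _ _
  · exact (isZero_zero _).eq_of_src _ _

/-- The cone of `f : X ⟶ Y` is the cokernel of `X ⟶ Y ⊞ I`, for an embedding of `X` into a
projective-injective object `I`. -/
lemma exists_triangle_mem (hE : IsFrobeniusClass E) {X Y : StableCat E} (f : X ⟶ Y) :
    ∃ (Z : StableCat E) (g : Y ⟶ Z) (h : Z ⟶ X⟦(1 : ℤ)⟧),
      Triangle.mk f g h ∈ d.distinguished := by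
  obtain ⟨f, rfl⟩ := (toStable E).map_surjective (X := X.as) (Y := Y.as) f
  obtain ⟨I, C, i, p, w, hS, hI⟩ := hE.exists_injective X.as
  obtain ⟨Z, q, w', hS'⟩ := hE.cone hS f
  refine ⟨(toStable E).obj Z, (toStableBiprodIso Y.as hI).hom ≫ (toStable E).map q,
    d.δ _ hS', _, hS', ⟨?_⟩⟩
  refine Triangle.isoMk _ _ (Iso.refl _) (toStableBiprodIso Y.as hI) (Iso.refl _) ?_ ?_ ?_
  · change (toStable E).map f ≫ _ = 𝟙 _ ≫ (toStable E).map (biprod.lift f i)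
    rw [Category.id_comp]
    exact toStable_map_comp_biprodIso_hom hI _ _ (by simp)
  · exact Category.comp_id _
  · change d.δ _ hS' ≫ (𝟙 _)⟦(1 : ℤ)⟧' = 𝟙 _ ≫ d.δ _ hS'
    simp

variable [∀ n : ℤ, (shiftFunctor (StableCat E) n).Additive]

/-- The bicartesian square attached to a map of short exact sequences `X ⟶ Y ⟶ Z` and
`X ⟶ I ⟶ C`, with `I` projective-injective, yields the rotated triangle. -/
lemma exists_rotate_iso (hE : IsFrobeniusClass E) {X Y Z I C : A} {f : X ⟶ Y} {g : Y ⟶ Z}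
    {w : f ≫ g = 0} {i : X ⟶ I} {p : I ⟶ C} {w' : i ≫ p = 0}
    (hS : E (ShortComplex.mk f g w)) (hS' : E (ShortComplex.mk i p w')) (hI : RelProjInj E I)
    (h : Y ⟶ I) (k : Z ⟶ C) (hf : f ≫ h = i) (hg : g ≫ k = h ≫ p) :
    Nonempty ((d.triangle _ hS).rotate ≅ d.triangle _ (hE.bicart_right hS hS' h k hf hg)) := by
  have := d.isIso _ hS' hI
  have n₁ := d.naturality _ _ hS hS' ⟨𝟙 X, h, k, by simp [hf], hg.symm⟩
  have n₂ := d.naturality _ _ hS' (hE.bicart_right hS hS' h k hf hg)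
    ⟨-f, -biprod.inr, 𝟙 C, by ext <;> simp [w, hf], by simp⟩
  dsimp only at n₁ n₂
  rw [(toStable E).map_id, (shiftFunctor (StableCat E) (1 : ℤ)).map_id, Category.comp_id] at n₁
  rw [(toStable E).map_id, Category.id_comp, Functor.map_neg, Functor.map_neg] at n₂
  refine ⟨Triangle.isoMk _ _ (Iso.refl _) (toStableBiprodIso Z hI) (asIso (d.δ _ hS')).symm
    ?_ ?_ ?_⟩
  · change (toStable E).map g ≫ _ = 𝟙 _ ≫ (toStable E).map (biprod.lift g h)
    rw [Category.id_comp]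
    exact toStable_map_comp_biprodIso_hom hI _ _ (by simp)
  · change d.δ (.mk f g w) hS ≫ inv (d.δ (.mk i p w') hS') =
      (toStable E).map biprod.inl ≫ (toStable E).map (biprod.desc k (-p))
    rw [IsIso.comp_inv_eq, ← n₁, ← Functor.map_comp, biprod.inl_desc]
  · change (-((toStable E).map f)⟦(1 : ℤ)⟧') ≫ (𝟙 _)⟦(1 : ℤ)⟧' =
      inv (d.δ (.mk i p w') hS') ≫
        d.δ (.mk (biprod.lift g h) (biprod.desc k (-p)) (by simp [hg]))
          (hE.bicart_right hS hS' h k hf hg)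
    rw [n₂, IsIso.inv_hom_id_assoc, (shiftFunctor (StableCat E) (1 : ℤ)).map_id, Category.comp_id]

lemma rotate_mem (hE : IsFrobeniusClass E) {T : Triangle (StableCat E)}
    (hT : T ∈ d.distinguished) : T.rotate ∈ d.distinguished := by
  obtain ⟨S, hS, ⟨e⟩⟩ := hT
  obtain ⟨I, C, i, p, w, hS', hI⟩ := hE.exists_injective S.X₁
  obtain ⟨φ, hφ⟩ := exists_hom_of_relInjective hE (S' := ShortComplex.mk i p w) hS hI.2 (𝟙 S.X₁)
  have h₁ := φ.comm₁₂
  rw [hφ] at h₁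
  obtain ⟨e'⟩ := d.exists_rotate_iso hE (f := S.f) (g := S.g) (w := S.zero) hS hS' hI φ.τ₂ φ.τ₃
    (by simpa using h₁.symm) φ.comm₂₃.symm
  exact ⟨_, _, ⟨(rotate _).mapIso e ≪≫ e'⟩⟩

/-- If `T.rotate` comes from `X ⟶ Y ⟶ Z`, and `K ⟶ P ⟶ Z` is a short exact sequence with `P`
projective-injective, then `T` comes from the short exact sequence `K ⟶ X ⊞ P ⟶ Y`. -/
lemma mem_of_rotate_mem (hE : IsFrobeniusClass E) {T : Triangle (StableCat E)}
    (hT : T.rotate ∈ d.distinguished) : T ∈ d.distinguished := by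
  obtain ⟨S, hS, ⟨e⟩⟩ := hT
  obtain ⟨P, K, k, p, w, hS', hP⟩ := hE.exists_projective S.X₃
  obtain ⟨φ, hφ⟩ := exists_hom_of_relProjective hE (S := ShortComplex.mk k p w) hS hP.1 (𝟙 S.X₃)
  have h₁ := φ.comm₂₃
  rw [hφ] at h₁
  have h₂ : φ.τ₂ ≫ S.g = p := by simpa using h₁
  have hS₁ := hE.bicart_left (a := S.f) (b := S.g) (w := S.zero) hS hS' φ.τ₂ φ.τ₁ h₂ φ.comm₁₂
  have comm : biprod.desc S.f φ.τ₂ ≫ S.g = biprod.snd ≫ p := by ext <;> simp [h₂]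
  obtain ⟨e'⟩ := d.exists_rotate_iso hE hS₁ hS' hP biprod.snd S.g (by simp) comm
  have hS₂ := hE.bicart_right hS₁ hS' biprod.snd S.g (by simp) comm
  let ψ : S ⟶ ShortComplex.mk (biprod.lift (biprod.desc S.f φ.τ₂) biprod.snd)
      (biprod.desc S.g (-p)) (by simp [comm]) :=
    ⟨biprod.inl, biprod.inl, 𝟙 _, by ext <;> simp, by simp⟩
  let e'' : d.triangle S hS ≅ d.triangle _ hS₂ :=
    Triangle.isoMk _ _ (toStableBiprodIso _ hP) (toStableBiprodIso _ hP) (Iso.refl _)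
      (d.triangleMap hS hS₂ ψ).comm₁
      (by
        have := (d.triangleMap hS hS₂ ψ).comm₂
        rw [d.triangleMap_hom₃] at this
        erw [(toStable E).map_id] at this
        exact this)
      (by
        have := (d.triangleMap hS hS₂ ψ).comm₃
        rw [d.triangleMap_hom₃] at this
        erw [(toStable E).map_id] at this
        exact this)
  exact ⟨_, hS₁, ⟨(rotate (StableCat E)).preimageIso (e ≪≫ e'' ≪≫ e'.symm)⟩⟩

omit [HasShift (StableCat E) ℤ] [∀ n : ℤ, (shiftFunctor (StableCat E) n).Additive] in
/-- A commutative square in the stable category between the first maps of two short exact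
sequences can be rectified to a map of short exact sequences. -/
lemma exists_hom_of_comm (hE : IsFrobeniusClass E) {S S' : ShortComplex A} (hS : E S)
    (a : (toStable E).obj S.X₁ ⟶ (toStable E).obj S'.X₁)
    (b : (toStable E).obj S.X₂ ⟶ (toStable E).obj S'.X₂)
    (h : (toStable E).map S.f ≫ b = a ≫ (toStable E).map S'.f) :
    ∃ φ : S ⟶ S', (toStable E).map φ.τ₁ = a ∧ (toStable E).map φ.τ₂ = b := by
  obtain ⟨a, rfl⟩ := (toStable E).map_surjective a
  obtain ⟨b, rfl⟩ := (toStable E).map_surjective b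
  rw [← Functor.map_comp, ← Functor.map_comp, toStable_map_eq_iff] at h
  obtain ⟨J, hJ, s, t, hst⟩ := h
  obtain ⟨r, hr⟩ := hJ.2 S hS s
  obtain ⟨c, hc⟩ := hE.desc hS ((b - r ≫ t) ≫ S'.g) (by
    rw [← Category.assoc, Preadditive.comp_sub, reassoc_of% hr, ← hst, sub_sub_cancel,
      Category.assoc, S'.zero, comp_zero])
  refine ⟨⟨a, b - r ≫ t, c, ?_, hc.symm⟩, rfl, ?_⟩
  · rw [Preadditive.comp_sub, reassoc_of% hr, ← hst, sub_sub_cancel]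
  · rw [toStable_map_eq_iff]
    exact ⟨J, hJ, -r, t, by simp⟩

omit [∀ n : ℤ, (shiftFunctor (StableCat E) n).Additive] in
lemma complete_morphism (hE : IsFrobeniusClass E) (T T' : Triangle (StableCat E))
    (hT : T ∈ d.distinguished) (hT' : T' ∈ d.distinguished) (a : T.obj₁ ⟶ T'.obj₁)
    (b : T.obj₂ ⟶ T'.obj₂) (h : T.mor₁ ≫ b = a ≫ T'.mor₁) :
    ∃ c : T.obj₃ ⟶ T'.obj₃, T.mor₂ ≫ c = b ≫ T'.mor₂ ∧ T.mor₃ ≫ a⟦1⟧' = c ≫ T'.mor₃ := by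
  obtain ⟨S, hS, ⟨e⟩⟩ := hT
  obtain ⟨S', hS', ⟨e'⟩⟩ := hT'
  refine exists_completion_of_iso e e' (fun a b h => ?_) a b h
  obtain ⟨φ, h₁, h₂⟩ := exists_hom_of_comm hE (S' := S') hS a b h
  exact ⟨d.triangleMap hS hS' φ, h₁, h₂⟩

/-- Happel's theorem: the stable category of a Frobenius category is pretriangulated. -/
@[reducible]
def pretriangulated (hE : IsFrobeniusClass E) : Pretriangulated (StableCat E) where
  distinguishedTriangles := d.distinguished
  isomorphic_distinguished _ h _ e := d.mem_of_iso e h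
  contractible_distinguished := d.contractible_mem hE
  distinguished_cocone_triangle f := d.exists_triangle_mem hE f
  rotate_distinguished_triangle _ := ⟨d.rotate_mem hE, d.mem_of_rotate_mem hE⟩
  complete_distinguished_triangle_morphism := d.complete_morphism hE

/-- The octahedral axiom. Up to isomorphism in the stable category, two composable morphisms can be
replaced by admissible monomorphisms, for which the third isomorphism theorem provides the
octahedron. -/
lemma isTriangulated (hE : IsFrobeniusClass E) :
    let _ := d.pretriangulated hE
    IsTriangulated (StableCat E) := by
  let _ := d.pretriangulated hE
  refine IsTriangulated.mk' fun X₁ X₂ X₃ u v => ?_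
  obtain ⟨u, rfl⟩ := (toStable E).map_surjective (X := X₁.as) (Y := X₂.as) u
  obtain ⟨v, rfl⟩ := (toStable E).map_surjective (X := X₂.as) (Y := X₃.as) v
  obtain ⟨I, C, i, p, w, hI, hI'⟩ := hE.exists_injective X₁.as
  obtain ⟨U, g, hfg, hS⟩ := hE.cone hI u
  obtain ⟨J, D, j, r, wJ, hJ, hJ'⟩ := hE.exists_injective (X₂.as ⊞ I)
  obtain ⟨V, g', hfg', hS'⟩ := hE.cone hJ (biprod.fst ≫ v)
  dsimp only at hfg hS hfg' hS' g g'
  obtain ⟨W, q, m, n, wq, wm, hq, hm, c₁, c₂⟩ := hE.comp hS hS'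
  generalize hf : biprod.lift u i = f at *
  generalize hf' : biprod.lift (biprod.fst ≫ v) j = f' at *
  have n₁ := d.naturality _ _ hS hq ⟨𝟙 _, f', m, by simp, c₁.symm⟩
  have n₂ := d.naturality _ _ hq hS' ⟨f, 𝟙 _, n, by simp, by simp [c₂]⟩
  have n₃ := d.naturality _ _ hS' hm ⟨g, q, 𝟙 _, c₁, by simp [c₂]⟩
  dsimp only at n₁ n₂ n₃
  rw [(toStable E).map_id, (shiftFunctor (StableCat E) (1 : ℤ)).map_id, Category.comp_id] at n₁
  rw [(toStable E).map_id, Category.id_comp] at n₃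
  refine ⟨_, _, _, _, _, _, (toStable E).map f, (toStable E).map f', Iso.refl _,
    toStableBiprodIso X₂.as hI', toStableBiprodIso X₃.as hJ', ?_, ?_,
    _, _, d.triangle_mem _ hS, _, _, d.triangle_mem _ hS', (toStable E).map q, d.δ _ hq, ?_,
    ⟨{ m₁ := (toStable E).map m
       m₃ := (toStable E).map n
       comm₁ := ?_
       comm₂ := n₁
       comm₃ := ?_
       comm₄ := n₂.symm
       mem := ?_ }⟩⟩
  · rw [Iso.refl_hom]
    erw [Category.id_comp]
    exact toStable_map_comp_biprodIso_hom hI' _ _ (by simp [← hf])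
  · rw [toStable_map_comp_biprodIso_hom hJ' _ (biprod.inl ≫ f') (by simp [← hf']),
      Functor.map_comp]
    rfl
  · rw [← Functor.map_comp]
    exact d.triangle_mem _ hq
  · rw [← Functor.map_comp, ← Functor.map_comp, c₁]
  · rw [← Functor.map_comp, c₂]
  · have := d.triangle_mem _ hm
    rw [triangle, n₃] at this
    exact this

end ConnectingMaps

end Triangulation

/-- Happel's theorem: the stable category of a Frobenius category has a triangulation whose
triangles are given by the short exact sequences. -/
theorem IsFrobeniusClass.nonempty_stableTriangulation {A : Type u'} [Category.{v'} A]
    [Preadditive A] [HasZeroObject A] [HasBinaryBiproducts A]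
    {E : ObjectProperty (ShortComplex A)} (hE : IsFrobeniusClass E) :
    Nonempty (StableTriangulation E) := by
  have := hE.susp_isEquivalence
  obtain ⟨_, ⟨u⟩⟩ := exists_hasShift hE.susp
  have : (shiftFunctor (StableCat E) (1 : ℤ)).Additive :=
    have := hE.susp_additive
    Functor.additive_of_iso u
  have := shiftFunctor_additive_of_one (C := StableCat E)
  let d : ConnectingMaps E :=
    { δ := fun S hS => hE.connecting hS ≫ u.hom.app _
      naturality := fun S S' hS hS' φ => by
        rw [← Category.assoc, hE.connecting_naturality hS hS' φ, Category.assoc, Category.assoc,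
          u.hom.naturality]
      isIso := fun S hS h => by
        have := hE.isIso_connecting hS h
        infer_instance }
  exact ⟨{
    hasShift := inferInstance
    additive := inferInstance
    pretriangulated := d.pretriangulated hE
    isTriangulated := d.isTriangulated hE
    δ := d.δ
    δ_naturality := d.naturality
    distinguished_iff := fun T => Iff.rfl }⟩

/-! ### Verdier quotients of stable categories -/

section VerdierQuotient

variable {C : Type u} [Category.{v} C] [Preadditive C] [HasZeroObject C] [HasShift C ℤ]
  [∀ n : ℤ, (shiftFunctor C n).Additive] [Pretriangulated C] [IsTriangulated C]

lemma isZero_localization_obj (K : ObjectProperty C) [K.IsTriangulated] {X : C} (hX : K X) :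
    IsZero (K.trW.Q.obj X) := by
  have h : K.trW (0 : X ⟶ 0) :=
    ⟨_, _, _, contractible_distinguished₂ X, K.le_shift 1 _ hX⟩
  have := Localization.inverts K.trW.Q K.trW _ h
  exact (K.trW.Q.map_isZero (isZero_zero C)).of_iso (asIso (K.trW.Q.map (0 : X ⟶ 0)))

omit [IsTriangulated C] in
lemma prop_obj₁_iff_prop_obj₃ (K : ObjectProperty C) [K.IsTriangulated]
    [K.IsClosedUnderIsomorphisms] (T : Triangle C) (hT : T ∈ distTriang C) (h : K T.obj₂) :
    K T.obj₁ ↔ K T.obj₃ :=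
  ⟨fun h₁ => K.ext_of_isTriangulatedClosed₃ T hT h₁ h,
    fun h₃ => K.ext_of_isTriangulatedClosed₁ T hT h h₃⟩

/-- If `b` has its cone in `K`, then so does `a` as soon as `a ≫ b` does. -/
lemma trW_of_trW_comp (K : ObjectProperty C) [K.IsTriangulated] [K.IsClosedUnderIsomorphisms]
    {X Y Z : C} (a : X ⟶ Y) (b : Y ⟶ Z) (hb : K.trW b) (hab : K.trW (a ≫ b)) : K.trW a := by
  obtain ⟨U, f, g, hT⟩ := distinguished_cocone_triangle a
  obtain ⟨V, f', g', hT', hV⟩ := hb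
  obtain ⟨W, f'', g'', hT'', hW⟩ := hab
  exact ⟨U, f, g, hT, K.ext_of_isTriangulatedClosed₁ _
    (Triangulated.someOctahedron rfl hT hT' hT'').mem hW hV⟩

variable {D : Type u'} [Category.{v'} D] [Preadditive D] [HasZeroObject D] [HasBinaryBiproducts D]

omit [IsTriangulated C] [HasZeroObject D] in
lemma additive_biprod_distinguished (F : D ⥤ C) [F.Additive] (X Y : D) :
    Triangle.mk (F.map (biprod.inr : Y ⟶ X ⊞ Y)) (F.map (biprod.fst : X ⊞ Y ⟶ X)) 0 ∈
      distTriang C := by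
  refine isomorphic_distinguished _ (binaryBiproductTriangle_distinguished (F.obj Y) (F.obj X)) _ ?_
  let e : F.obj (X ⊞ Y) ≅ F.obj Y ⊞ F.obj X :=
    { hom := biprod.lift (F.map biprod.snd) (F.map biprod.fst)
      inv := biprod.desc (F.map biprod.inr) (F.map biprod.inl)
      hom_inv_id := by
        rw [biprod.lift_desc, ← F.map_comp, ← F.map_comp, ← F.map_add, add_comm, biprod.total,
          F.map_id]
      inv_hom_id := by
        ext <;> simp [← F.map_comp] }
  refine Triangle.isoMk _ _ (Iso.refl _) e (Iso.refl _) ?_ ?_ ?_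
  · change F.map biprod.inr ≫ e.hom = 𝟙 _ ≫ biprod.inl
    ext <;> simp [e, ← F.map_comp]
  · change F.map biprod.fst ≫ 𝟙 _ = e.hom ≫ biprod.snd
    simp [e]
  · exact zero_comp.trans comp_zero.symm

end VerdierQuotient

section StableTriangulation

variable {A : Type u'} [Category.{v'} A] [Preadditive A] [HasZeroObject A] [HasBinaryBiproducts A]
  (E : ObjectProperty (ShortComplex A)) [StableTriangulation E]

namespace StableTriangulation

/-- The distinguished triangle of a short exact sequence. -/
abbrev triangle (S : ShortComplex A) (hS : E S) : Triangle (StableCat E) :=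
  Triangle.mk ((toStable E).map S.f) ((toStable E).map S.g) (δ S hS)

lemma triangle_distinguished (S : ShortComplex A) (hS : E S) :
    triangle E S hS ∈ distTriang (StableCat E) :=
  (distinguished_iff _).2 ⟨S, hS, ⟨Iso.refl _⟩⟩

lemma isIso_δ (S : ShortComplex A) (hS : E S) (h : RelProjInj E S.X₂) : IsIso (δ S hS) :=
  ((triangle E S hS).isZero₂_iff_isIso₃ (triangle_distinguished E S hS)).1 (toStable_isZero h)

end StableTriangulation

variable {E} (E' : ObjectProperty (ShortComplex A)) [StableTriangulation E']
  (K : ObjectProperty (StableCat E))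

/-- The objects of the stable category of `E'` which belong to `K` when they are considered as
objects of the stable category of `E`. -/
def sameObjects : ObjectProperty (StableCat E') := fun X => K ((toStable E).obj X.as)

variable {E'} [K.IsTriangulated]

lemma prop_biprod_of_prop [K.IsStableUnderRetracts] {Y J : A} (hY : K ((toStable E).obj Y))
    (hJ : K ((toStable E).obj J)) :
    K ((toStable E).obj (Y ⊞ J)) :=
  K.ext_of_isTriangulatedClosed₂ _ (additive_biprod_distinguished (toStable E) Y J) hJ hY

lemma trW_map_biprod_fst (Y : A) {J : A} (hJ : K ((toStable E).obj J)) :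
    K.trW ((toStable E).map (biprod.fst : Y ⊞ J ⟶ Y)) :=
  ObjectProperty.trW.mk' K (additive_biprod_distinguished (toStable E) Y J) hJ

variable (hE' : IsFrobeniusClass E') (hle : E' ≤ E)
  (hK : ∀ J, RelProjInj E' J → K ((toStable E).obj J))

omit [StableTriangulation E'] in
include hK in
/-- A retract of `Y` in the stable category of `E'` is a retract of `Y ⊞ J` in the category itself,
for some projective-injective `J`. -/
lemma sameObjects_isStableUnderRetracts [K.IsStableUnderRetracts] :
     (sameObjects E' K).IsStableUnderRetracts where
  of_retract {X Y} r hY := by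
    obtain ⟨i, hi⟩ := (toStable E').map_surjective (X := X.as) (Y := Y.as) r.i
    obtain ⟨p, hp⟩ := (toStable E').map_surjective (X := Y.as) (Y := X.as) r.r
    have h : (toStable E').map (i ≫ p) = (toStable E').map (𝟙 X.as) := by
      rw [Functor.map_comp, hi, hp, (toStable E').map_id]
      exact r.retract
    rw [toStable_map_eq_iff] at h
    obtain ⟨J, hJ, a, b, hab⟩ := h
    let ρ : Retract X.as (Y.as ⊞ J) :=
      { i := biprod.lift i a
        r := biprod.desc p (-b)
        retract := by
          rw [biprod.lift_desc, Preadditive.comp_neg, ← hab]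
          abel }
    exact K.prop_of_retract (ρ.map (toStable E)) (prop_biprod_of_prop K hY (hK J hJ))

include hE' hle hK in
/-- Both suspensions are cosyzygies with respect to `E'`, up to objects of `K`, and the triangles of
the stable category of `E'` come from short exact sequences which also belong to `E`. -/
lemma sameObjects_isTriangulated [K.IsStableUnderRetracts] :
    (sameObjects E' K).IsTriangulated := by
  have hr := sameObjects_isStableUnderRetracts K hK
  have key (X : StableCat E') :
      sameObjects E' K X ↔ sameObjects E' K (X⟦(1 : ℤ)⟧) := by
    obtain ⟨I, C, i, p, w, hS, hI⟩ := hE'.exists_injective X.as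
    have := StableTriangulation.isIso_δ E' _ hS hI
    exact (prop_obj₁_iff_prop_obj₃ K _ (StableTriangulation.triangle_distinguished E _ (hle _ hS))
      (hK _ hI)).trans
        ((sameObjects E' K).prop_iff_of_iso (asIso (StableTriangulation.δ _ hS)))
  have key' (n : ℤ) : ∀ X, sameObjects E' K X ↔ sameObjects E' K (X⟦n⟧) := by
    refine int_induction_iff
      (p := fun n => ∀ X, sameObjects E' K X ↔ sameObjects E' K (X⟦n⟧)) ?_ ?_ n
    · exact fun X => (sameObjects E' K).prop_iff_of_iso ((shiftFunctorZero _ ℤ).symm.app X)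
    · refine fun i => forall_congr' fun X => ?_
      rw [(sameObjects E' K).prop_iff_of_iso ((shiftFunctorAdd _ i 1).app X), key (X⟦i⟧)]
      rfl
  exact {
    exists_zero := ⟨_, (toStable E').map_isZero (isZero_zero A), hK 0 (relProjInj_zero E')⟩
    isStableUnderShiftBy := fun n => ⟨fun X hX => (key' n X).1 hX⟩
    toIsTriangulatedClosed₂ := .mk' fun T hT h₁ h₃ => by
      obtain ⟨S, hS, ⟨e⟩⟩ := (StableTriangulation.distinguished_iff T).1 hT
      refine (sameObjects E' K).prop_of_iso (Triangle.π₂.mapIso e).symm ?_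
      exact K.ext_of_isTriangulatedClosed₂ _
        (StableTriangulation.triangle_distinguished E _ (hle _ hS))
        ((sameObjects E' K).prop_of_iso (Triangle.π₁.mapIso e) h₁)
        ((sameObjects E' K).prop_of_iso (Triangle.π₃.mapIso e) h₃) }

/-- The functor from the stable category of `E'` to the Verdier quotient by `K` of the stable
category of `E`: the identity on objects. -/
noncomputable def toVerdierQuotient : StableCat E' ⥤ K.trW.Localization :=
  CategoryTheory.Quotient.lift _ (toStable E ⋙ K.trW.Q) (by
    rintro X Y f g ⟨J, hJ, a, b, hab⟩
    have h : (toStable E ⋙ K.trW.Q).map (f - g) = 0 := by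
      rw [hab, Functor.map_comp,
        (isZero_localization_obj K (hK J hJ)).eq_zero_of_tgt ((toStable E ⋙ K.trW.Q).map a),
        zero_comp]
    rwa [Functor.map_sub, sub_eq_zero] at h)

omit [StableTriangulation E'] in
lemma toStable_comp_toVerdierQuotient :
    toStable E' ⋙ toVerdierQuotient K hK = toStable E ⋙ K.trW.Q :=
  CategoryTheory.Quotient.lift_spec _ _ _

/-- The connecting map, in the Verdier quotient, of a short exact sequence in `E'`. -/
noncomputable def quotientδ (S : ShortComplex A) (hS : E S) :
    K.trW.Q.obj ((toStable E).obj S.X₃) ⟶ (K.trW.Q.obj ((toStable E).obj S.X₁))⟦(1 : ℤ)⟧ :=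
  K.trW.Q.map (StableTriangulation.δ S hS) ≫ (K.trW.Q.commShiftIso (1 : ℤ)).hom.app _

lemma quotientδ_naturality {S S' : ShortComplex A} (hS : E S) (hS' : E S') (φ : S ⟶ S') :
    K.trW.Q.map ((toStable E).map φ.τ₃) ≫ quotientδ K S' hS' =
      quotientδ K S hS ≫ (K.trW.Q.map ((toStable E).map φ.τ₁))⟦(1 : ℤ)⟧' := by
  dsimp only [quotientδ]
  rw [← Functor.map_comp_assoc, StableTriangulation.δ_naturality S S' hS hS' φ,
    Functor.map_comp, Category.assoc, Category.assoc]
  congr 1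
  exact K.trW.Q.commShiftIso_hom_naturality _ _

lemma quotientδ_triangle_distinguished (S : ShortComplex A) (hS : E S) :
    Triangle.mk (K.trW.Q.map ((toStable E).map S.f)) (K.trW.Q.map ((toStable E).map S.g))
      (quotientδ K S hS) ∈ distTriang K.trW.Localization :=
  K.trW.Q.map_distinguished _ (StableTriangulation.triangle_distinguished E S hS)

lemma isIso_quotientδ (S : ShortComplex A) (hS : E S) (h : K ((toStable E).obj S.X₂)) :
    IsIso (quotientδ K S hS) :=
  (Triangle.isZero₂_iff_isIso₃ _ (quotientδ_triangle_distinguished K S hS)).1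
    (isZero_localization_obj K h)

include hE' hle in
/-- Both suspensions are computed by the cosyzygies with respect to `E'`. -/
lemma exists_shift_iso :
    ∃ e : shiftFunctor (StableCat E') (1 : ℤ) ⋙ toVerdierQuotient K hK ≅
        toVerdierQuotient K hK ⋙ shiftFunctor _ (1 : ℤ),
      ∀ (S : ShortComplex A) (hS : E' S),
        (toVerdierQuotient K hK).map (StableTriangulation.δ S hS) ≫
          e.hom.app ((toStable E').obj S.X₁) = quotientδ K S (hle S hS) := by
  have hδ (X : A) := StableTriangulation.isIso_δ E' _ (hE'.cosyzygySeq_mem X)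
    (hE'.cosyzygySeq_projInj X)
  have hδ' (X : A) := isIso_quotientδ K _ (hle _ (hE'.cosyzygySeq_mem X))
    (hK _ (hE'.cosyzygySeq_projInj X))
  let ι (X : A) : (toVerdierQuotient K hK).obj (((toStable E').obj X)⟦(1 : ℤ)⟧) ≅
      ((toVerdierQuotient K hK).obj ((toStable E').obj X))⟦(1 : ℤ)⟧ :=
    (toVerdierQuotient K hK).mapIso
        (asIso (StableTriangulation.δ _ (hE'.cosyzygySeq_mem X))).symm ≪≫
      @asIso _ _ _ _ (quotientδ K _ (hle _ (hE'.cosyzygySeq_mem X))) (hδ' X)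
  have key (S : ShortComplex A) (hS : E' S) :
      (toVerdierQuotient K hK).map (StableTriangulation.δ S hS) ≫ (ι S.X₁).hom =
        quotientδ K S (hle S hS) := by
    have n₁ := StableTriangulation.δ_naturality _ _ hS (hE'.cosyzygySeq_mem S.X₁)
      (hE'.toCosyzygySeq hS (𝟙 S.X₁))
    have n₂ := quotientδ_naturality K (hle _ hS) (hle _ (hE'.cosyzygySeq_mem S.X₁))
      (hE'.toCosyzygySeq hS (𝟙 S.X₁))
    rw [hE'.toCosyzygySeq_τ₁, (toStable E').map_id,
      (shiftFunctor (StableCat E') (1 : ℤ)).map_id, Category.comp_id] at n₁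
    rw [hE'.toCosyzygySeq_τ₁, (toStable E).map_id, K.trW.Q.map_id,
      (shiftFunctor K.trW.Localization (1 : ℤ)).map_id, Category.comp_id] at n₂
    rw [← n₂, ← n₁]
    dsimp only [ι, Iso.trans_hom, Functor.mapIso_hom, Iso.symm_hom, asIso_inv, asIso_hom]
    rw [← Functor.map_comp_assoc, Category.assoc, IsIso.hom_inv_id, Category.comp_id]
    rfl
  refine ⟨NatIso.ofComponents (fun X => ι X.as) ?_, key⟩
  intro X Y f
  obtain ⟨f, rfl⟩ := (toStable E').map_surjective (X := X.as) (Y := Y.as) f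
  have n₁ := StableTriangulation.δ_naturality _ _ (hE'.cosyzygySeq_mem X.as)
    (hE'.cosyzygySeq_mem Y.as) (hE'.toCosyzygySeq (hE'.cosyzygySeq_mem X.as) f)
  have n₂ := quotientδ_naturality K (hle _ (hE'.cosyzygySeq_mem X.as))
    (hle _ (hE'.cosyzygySeq_mem Y.as)) (hE'.toCosyzygySeq (hE'.cosyzygySeq_mem X.as) f)
  rw [hE'.toCosyzygySeq_τ₁] at n₁ n₂
  have n₃ : (toVerdierQuotient K hK).map (((toStable E').map f)⟦(1 : ℤ)⟧') =
      (toVerdierQuotient K hK).map (inv (StableTriangulation.δ _ (hE'.cosyzygySeq_mem X.as))) ≫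
      (toVerdierQuotient K hK).map ((toStable E').map
        (hE'.toCosyzygySeq (hE'.cosyzygySeq_mem X.as) f).τ₃) ≫
      (toVerdierQuotient K hK).map (StableTriangulation.δ _ (hE'.cosyzygySeq_mem Y.as)) := by
    rw [← Functor.map_comp, ← Functor.map_comp, n₁, IsIso.inv_hom_id_assoc]
  have n₄ : (toVerdierQuotient K hK).map (StableTriangulation.δ _ (hE'.cosyzygySeq_mem Y.as)) ≫
      (ι Y.as).hom = quotientδ K _ (hle _ (hE'.cosyzygySeq_mem Y.as)) :=
    key _ (hE'.cosyzygySeq_mem Y.as)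
  change (toVerdierQuotient K hK).map (((toStable E').map f)⟦(1 : ℤ)⟧') ≫ (ι Y.as).hom =
    (ι X.as).hom ≫ (K.trW.Q.map ((toStable E).map f))⟦(1 : ℤ)⟧'
  rw [n₃, Category.assoc, Category.assoc, n₄]
  dsimp only [ι, Iso.trans_hom, Functor.mapIso_hom, Iso.symm_hom, asIso_inv, asIso_hom]
  rw [Category.assoc]
  exact congrArg (_ ≫ ·) n₂

end StableTriangulation

/-! ### The equivalence of Verdier quotients -/

section Comparison

variable {A : Type u'} [Category.{v'} A] [Preadditive A] [HasZeroObject A] [HasBinaryBiproducts A]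
  {E E' : ObjectProperty (ShortComplex A)} [StableTriangulation E] [StableTriangulation E']
  (K : ObjectProperty (StableCat E)) [K.IsTriangulated]
  (hE' : IsFrobeniusClass E') (hle : E' ≤ E)
  (hK : ∀ J, RelProjInj E' J → K ((toStable E).obj J))

include hE' hle in
/-- The identity on objects is a triangulated functor, since the triangles of both categories are
given by short exact sequences, with compatible connecting maps. -/
lemma exists_toVerdierQuotient_isTriangulated :
    ∃ _ : (toVerdierQuotient K hK).CommShift ℤ, (toVerdierQuotient K hK).IsTriangulated := by
  obtain ⟨e, he⟩ := exists_shift_iso K hE' hle hK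
  obtain ⟨c, hc⟩ := exists_commShift (toVerdierQuotient K hK) e
  refine ⟨c, ⟨fun T hT => ?_⟩⟩
  obtain ⟨S, hS, ⟨t⟩⟩ := (StableTriangulation.distinguished_iff T).1 hT
  refine isomorphic_distinguished _ (quotientδ_triangle_distinguished K S (hle S hS)) _
    ((toVerdierQuotient K hK).mapTriangle.mapIso t ≪≫ Triangle.isoMk _ _ (Iso.refl _)
      (Iso.refl _) (Iso.refl _) ?_ ?_ ?_)
  · exact (Category.comp_id _).trans (Category.id_comp _).symm
  · exact (Category.comp_id _).trans (Category.id_comp _).symm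
  · refine (congrArg (_ ≫ ·) ((shiftFunctor K.trW.Localization (1 : ℤ)).map_id _)).trans ?_
    refine (Category.comp_id _).trans (Eq.trans ?_ (Category.id_comp _).symm)
    refine Eq.trans ?_ (he S hS)
    rw [← hc]
    rfl

lemma toVerdierQuotient_inverts [(sameObjects E' K).IsTriangulated]
    [(toVerdierQuotient K hK).CommShift ℤ] [(toVerdierQuotient K hK).IsTriangulated] :
    (sameObjects E' K).trW.IsInvertedBy (toVerdierQuotient K hK) := by
  rintro X Y f ⟨Z, g, h, hT, hZ⟩
  exact (Triangle.isZero₃_iff_isIso₁ _ ((toVerdierQuotient K hK).map_distinguished _ hT)).1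
    (isZero_localization_obj K hZ)

/-- The functor from the stable category of `E` to the Verdier quotient of the stable category of
`E'`: the identity on objects. -/
noncomputable def fromStable (hle : E' ≤ E) [(sameObjects E' K).IsTriangulated] :
    StableCat E ⥤ (sameObjects E' K).trW.Localization :=
  CategoryTheory.Quotient.lift _ (toStable E' ⋙ (sameObjects E' K).trW.Q) (by
    rintro X Y f g ⟨J, hJ, a, b, hab⟩
    have hJ' : RelProjInj E' J := ⟨fun S hS => hJ.1 S (hle S hS), fun S hS => hJ.2 S (hle S hS)⟩
    have h := (toStable_map_eq_iff (E := E') f g).2 ⟨J, hJ', a, b, hab⟩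
    exact congrArg (sameObjects E' K).trW.Q.map h)

omit [StableTriangulation E] [K.IsTriangulated] in
lemma toStable_comp_fromStable [(sameObjects E' K).IsTriangulated] :
    toStable E ⋙ fromStable K hle = toStable E' ⋙ (sameObjects E' K).trW.Q :=
  CategoryTheory.Quotient.lift_spec _ _ _

include hE' hK in
/-- A map of `A` whose cone in the stable category of `E` lies in `K` has its cone in the stable
category of `E'` among the same objects, because both cones are given by one short exact sequence
in `E'`. -/
lemma fromStable_inverts [K.IsStableUnderRetracts] [(sameObjects E' K).IsTriangulated] :
    K.trW.IsInvertedBy (fromStable K hle) := by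
  intro X Y f hf
  obtain ⟨f, rfl⟩ := (toStable E).map_surjective (X := X.as) (Y := Y.as) f
  obtain ⟨I, C, i, p, w, hS, hI⟩ := hE'.exists_injective X.as
  -- `f` is the composite of the admissible monomorphism `(f, i)` and of the projection from
  -- `Y ⊞ I`, which is invertible in the stable category of `E'`
  obtain ⟨Z, q, w', hT⟩ := hE'.cone hS f
  have h₁ : K.trW ((toStable E).map (biprod.lift f i)) := by
    refine trW_of_trW_comp K _ _ (trW_map_biprod_fst K Y.as (hK I hI)) ?_
    rwa [← Functor.map_comp, biprod.lift_fst]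
  have h₂ : K ((toStable E).obj Z) :=
    (K.trW_iff_of_distinguished _
      (StableTriangulation.triangle_distinguished E _ (hle _ hT))).1 h₁
  have h₃ : (sameObjects E' K).trW ((toStable E').map (biprod.lift f i)) :=
    ObjectProperty.trW.mk _ (StableTriangulation.triangle_distinguished E' _ hT) h₂
  have h₄ := Localization.inverts (sameObjects E' K).trW.Q _ _ h₃
  have h₅ : IsIso ((toStable E').map (biprod.fst : Y.as ⊞ I ⟶ Y.as)) :=
    (toStableBiprodIso Y.as hI).isIso_inv
  have h₆ : IsIso ((sameObjects E' K).trW.Q.map ((toStable E').map (biprod.lift f i)) ≫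
      (sameObjects E' K).trW.Q.map ((toStable E').map (biprod.fst : Y.as ⊞ I ⟶ Y.as))) :=
    inferInstance
  rw [← Functor.map_comp, ← Functor.map_comp, biprod.lift_fst] at h₆
  exact h₆

include hE' hle in
/-- The functors which are the identity on objects induce mutually inverse functors between the
Verdier quotients. -/
lemma lift_toVerdierQuotient_isEquivalence [K.IsStableUnderRetracts]
    [(sameObjects E' K).IsTriangulated]
    (h : (sameObjects E' K).trW.IsInvertedBy (toVerdierQuotient K hK)) :
    (Localization.Construction.lift _ h).IsEquivalence := by
  have h' := fromStable_inverts K hE' hle hK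
  have h₁ : toVerdierQuotient K hK ⋙ Localization.Construction.lift _ h' =
      (sameObjects E' K).trW.Q := by
    refine CategoryTheory.Quotient.lift_unique' _ _ _ ?_
    rw [← toStable_comp_fromStable K hle, ← Functor.assoc, toStable_comp_toVerdierQuotient,
      Functor.assoc, Localization.Construction.fac]
  have h₂ : fromStable K hle ⋙ Localization.Construction.lift _ h = K.trW.Q := by
    refine CategoryTheory.Quotient.lift_unique' _ _ _ ?_
    rw [← toStable_comp_toVerdierQuotient K hK, ← Functor.assoc, toStable_comp_fromStable,
      Functor.assoc, Localization.Construction.fac]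
  have h₃ : Localization.Construction.lift _ h ⋙ Localization.Construction.lift _ h' = 𝟭 _ :=
    Localization.Construction.uniq _ _ (by
      rw [← Functor.assoc, Localization.Construction.fac, h₁, Functor.comp_id])
  have h₄ : Localization.Construction.lift _ h' ⋙ Localization.Construction.lift _ h = 𝟭 _ :=
    Localization.Construction.uniq _ _ (by
      rw [← Functor.assoc, Localization.Construction.fac, h₂, Functor.comp_id])
  exact (CategoryTheory.Equivalence.mk _ _ (eqToIso h₃.symm) (eqToIso h₄)).isEquivalence_functor

/-- A triangulated functor which inverts the maps with cone in `P` induces a triangulated functor on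
the Verdier quotient. -/
lemma lift_isTriangulated {C : Type u} [Category.{v} C] [Preadditive C] [HasZeroObject C]
    [HasShift C ℤ] [∀ n : ℤ, (shiftFunctor C n).Additive] [Pretriangulated C] [IsTriangulated C]
    {D : Type u'} [Category.{v'} D] [Preadditive D] [HasZeroObject D]
    [HasShift D ℤ] [∀ n : ℤ, (shiftFunctor D n).Additive] [Pretriangulated D]
    (P : ObjectProperty C) [P.IsTriangulated] (F : C ⥤ D) [F.CommShift ℤ] [F.IsTriangulated]
    (h : P.trW.IsInvertedBy F) :
    ∃ (_ : (Localization.Construction.lift F h).CommShift ℤ)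
      (e : P.trW.Q ⋙ Localization.Construction.lift F h ≅ F),
      (Localization.Construction.lift F h).IsTriangulated ∧ NatTrans.CommShift e.hom ℤ := by
  let : (Localization.Construction.lift F h).CommShift ℤ :=
    Functor.commShiftOfLocalization P.trW.Q P.trW ℤ F _
  have he : NatTrans.CommShift
      (Localization.Lifting.iso P.trW.Q P.trW F (Localization.Construction.lift F h)).hom ℤ :=
    NatTrans.commShift_iso_hom_of_localization P.trW.Q P.trW ℤ F _
  have := Localization.essSurj_mapArrow P.trW.Q P.trW
  exact ⟨_, Localization.Lifting.iso P.trW.Q P.trW F (Localization.Construction.lift F h),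
    Functor.isTriangulated_of_precomp_iso
      (Localization.Lifting.iso P.trW.Q P.trW F (Localization.Construction.lift F h)), he⟩

include hE' hle hK in
/-- For Frobenius classes `E' ≤ E` and a thick subcategory `K` of the stable category of `E` which
contains the objects that are projective-injective for `E'`, the stable categories of `E` and `E'`
have the same Verdier quotient by the objects of `K`. -/
theorem exists_verdierQuotient_equivalence [K.IsStableUnderRetracts] :
    ∃ (_ : (sameObjects E' K).IsTriangulated) (_ : (sameObjects E' K).IsStableUnderRetracts)
      (ψ : StableCat E' ⥤ K.trW.Localization) (_ : ψ.CommShift ℤ)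
      (φ : (sameObjects E' K).trW.Localization ⥤ K.trW.Localization)
      (_ : φ.CommShift ℤ) (e : (sameObjects E' K).trW.Q ⋙ φ ≅ ψ),
      Nonempty (toStable E' ⋙ ψ ≅ toStable E ⋙ K.trW.Q) ∧
      ψ.IsTriangulated ∧ φ.IsTriangulated ∧ NatTrans.CommShift e.hom ℤ ∧ φ.IsEquivalence := by
  have hs := sameObjects_isTriangulated K hE' hle hK
  obtain ⟨c, hψ⟩ := exists_toVerdierQuotient_isTriangulated K hE' hle hK
  have h := toVerdierQuotient_inverts K hK
  obtain ⟨c', e, hφ, he⟩ := lift_isTriangulated (sameObjects E' K) (toVerdierQuotient K hK) h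
  exact ⟨hs, sameObjects_isStableUnderRetracts K hK, toVerdierQuotient K hK, c, _, c', e,
    ⟨eqToIso (toStable_comp_toVerdierQuotient K hK)⟩, hψ, hφ, he,
    lift_toVerdierQuotient_isEquivalence K hE' hle hK h⟩

end Comparison

/-! ### Relative exact structures on an abelian category -/

section RelativeExact

variable {A : Type u} [Category.{v} A] [Abelian A] {B : Type u'} [Category.{v'} B]
  [Preadditive B] [Balanced B]
  (F : A ⥤ B) [F.Additive] (c : Prop)

/-- The short exact sequences of `A` which, in case `c` holds, are split by the functor `F`. The
parameter `c` makes it possible to treat all short exact sequences and those which are split by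
`F` at once. -/
def relativeExact : ObjectProperty (ShortComplex A) := fun S =>
  S.ShortExact ∧ (c → Nonempty (S.map F).Splitting)

variable {F c} (hF : ∀ S : ShortComplex A, S.ShortExact → (S.map F).ShortExact)
include hF

lemma relativeExact_of_retraction {S : ShortComplex A} (hS : S.ShortExact)
    (h : c → ∃ r : F.obj S.X₂ ⟶ F.obj S.X₁, F.map S.f ≫ r = 𝟙 _) : relativeExact F c S := by
  refine ⟨hS, fun hc => ?_⟩
  obtain ⟨r, hr⟩ := h hc
  exact ⟨.ofExactOfRetraction _ (hF S hS).exact r hr (hF S hS).epi_g⟩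

lemma relativeExact_of_section {S : ShortComplex A} (hS : S.ShortExact)
    (h : c → ∃ s : F.obj S.X₃ ⟶ F.obj S.X₂, s ≫ F.map S.g = 𝟙 _) : relativeExact F c S := by
  refine ⟨hS, fun hc => ?_⟩
  obtain ⟨s, hs⟩ := h hc
  exact ⟨.ofExactOfSection _ (hF S hS).exact s hs (hF S hS).mono_f⟩

omit hF in
lemma shortExact_cokernel {X Y : A} (f : X ⟶ Y) [Mono f] :
    (ShortComplex.mk f (cokernel.π f) (cokernel.condition f)).ShortExact where
  exact := ShortComplex.exact_cokernel f

omit hF in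
lemma shortExact_kernel {X Y : A} (f : X ⟶ Y) [Epi f] :
    (ShortComplex.mk (kernel.ι f) f (kernel.condition f)).ShortExact where
  exact := ShortComplex.exact_kernel f

lemma relativeExact_cone {S : ShortComplex A} (hS : relativeExact F c S) {Y : A} (f : S.X₁ ⟶ Y) :
    relativeExact F c (ShortComplex.mk (biprod.lift f S.f) _ (cokernel.condition _)) := by
  have := hS.1.mono_f
  have : Mono (biprod.lift f S.f ≫ biprod.snd) := by rwa [biprod.lift_snd]
  have : Mono (biprod.lift f S.f) := mono_of_mono _ biprod.snd
  refine relativeExact_of_retraction hF (shortExact_cokernel _) fun hc => ?_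
  obtain ⟨s⟩ := hS.2 hc
  let r : F.obj S.X₂ ⟶ F.obj S.X₁ := s.r
  have hr : F.map S.f ≫ r = 𝟙 (F.obj S.X₁) := s.f_r
  refine ⟨F.map biprod.snd ≫ r, ?_⟩
  change F.map (biprod.lift f S.f) ≫ F.map biprod.snd ≫ r = 𝟙 (F.obj S.X₁)
  rwa [← Functor.map_comp_assoc, biprod.lift_snd]

lemma relativeExact_bicart_right {X Y Z I C : A} {f : X ⟶ Y} {g : Y ⟶ Z} {w : f ≫ g = 0}
    {i : X ⟶ I} {p : I ⟶ C} {w' : i ≫ p = 0} (hS : relativeExact F c (ShortComplex.mk f g w))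
    (hS' : relativeExact F c (ShortComplex.mk i p w')) (h : Y ⟶ I) (k : Z ⟶ C) (hf : f ≫ h = i)
    (hg : g ≫ k = h ≫ p) :
    relativeExact F c
      (ShortComplex.mk (biprod.lift g h) (biprod.desc k (-p)) (by simp [hg])) := by
  have : Mono i := hS'.1.mono_f
  have : Epi g := hS.1.epi_g
  have : Epi p := hS'.1.epi_g
  have : Mono f := hS.1.mono_f
  have : Epi (-p) := ⟨fun a b hab => by simpa [cancel_epi] using hab⟩
  have : Epi (biprod.inr ≫ biprod.desc k (-p)) := by rwa [biprod.inr_desc]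
  have : Epi (biprod.desc k (-p)) := epi_of_epi biprod.inr _
  have : Mono (biprod.lift g h) := by
    refine Preadditive.mono_of_cancel_zero _ fun {T} a ha => ?_
    have h₁ : a ≫ g = 0 := by simpa using ha =≫ biprod.fst
    have h₂ : a ≫ h = 0 := by simpa using ha =≫ biprod.snd
    obtain ⟨b, hb⟩ : ∃ b, b ≫ f = a := ⟨hS.1.exact.lift a h₁, hS.1.exact.lift_f a h₁⟩
    have h₃ : b ≫ i = 0 := by rw [← hf, reassoc_of% hb, h₂]
    rw [← hb, zero_of_comp_mono i h₃, zero_comp]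
  refine relativeExact_of_section hF { exact := ?_ } fun hc => ?_
  · rw [ShortComplex.exact_iff_exact_up_to_refinements]
    intro T x hx
    obtain ⟨T', π, hπ, y, hy⟩ := surjective_up_to_refinements_of_epi g (x ≫ biprod.fst)
    have h₁ : x ≫ biprod.fst ≫ k = x ≫ biprod.snd ≫ p := by
      have : x ≫ biprod.desc k (-p) = 0 := hx
      simp only [biprod.desc_eq, Preadditive.comp_add, Preadditive.comp_neg] at this
      rwa [← sub_eq_add_neg, sub_eq_zero] at this
    have h₂ : (π ≫ x ≫ biprod.snd - y ≫ h) ≫ p = 0 := by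
      have h₃ : π ≫ x ≫ biprod.fst ≫ k = y ≫ g ≫ k := by
        rw [← Category.assoc y, ← hy, Category.assoc, Category.assoc]
      simp only [Preadditive.sub_comp, Category.assoc]
      rw [← h₁, h₃, hg, sub_self]
    obtain ⟨z, hz⟩ : ∃ z, z ≫ i = π ≫ x ≫ biprod.snd - y ≫ h :=
      ⟨hS'.1.exact.lift _ h₂, hS'.1.exact.lift_f _ h₂⟩
    refine ⟨T', π, hπ, y + z ≫ f, ?_⟩
    apply biprod.hom_ext
    · simp [w, hy]
    · simp [hf, hz]
  · obtain ⟨s⟩ := hS'.2 hc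
    let t : F.obj C ⟶ F.obj I := s.s
    have ht : t ≫ F.map p = 𝟙 (F.obj C) := s.s_g
    refine ⟨t ≫ F.map (-biprod.inr), ?_⟩
    change (t ≫ F.map (-biprod.inr)) ≫ F.map (biprod.desc k (-p)) = 𝟙 (F.obj C)
    rwa [Category.assoc, ← Functor.map_comp, Preadditive.neg_comp, biprod.inr_desc, neg_neg]

lemma relativeExact_bicart_left {X Y C K P : A} {a : X ⟶ Y} {b : Y ⟶ C} {w : a ≫ b = 0}
    {k : K ⟶ P} {p : P ⟶ C} {w' : k ≫ p = 0} (hS : relativeExact F c (ShortComplex.mk a b w))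
    (hS' : relativeExact F c (ShortComplex.mk k p w')) (s : P ⟶ Y) (h : K ⟶ X)
    (hs : s ≫ b = p) (hk : h ≫ a = k ≫ s) :
    relativeExact F c (ShortComplex.mk (biprod.lift (-h) k) (biprod.desc a s) (by simp [hk])) := by
  have : Mono a := hS.1.mono_f
  have : Epi b := hS.1.epi_g
  have : Epi p := hS'.1.epi_g
  have : Mono k := hS'.1.mono_f
  have : Mono (biprod.lift (-h) k ≫ biprod.snd) := by rwa [biprod.lift_snd]
  have : Mono (biprod.lift (-h) k) := mono_of_mono _ biprod.snd
  have : Epi (biprod.desc a s) := by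
    refine Preadditive.epi_of_cancel_zero _ fun {T} t ht => ?_
    have h₁ : a ≫ t = 0 := by simpa using biprod.inl ≫= ht
    have h₂ : s ≫ t = 0 := by simpa using biprod.inr ≫= ht
    obtain ⟨t, rfl⟩ : ∃ t', b ≫ t' = t := ⟨hS.1.exact.desc t h₁, hS.1.exact.g_desc t h₁⟩
    have h₃ : p ≫ t = 0 := by rw [← hs, Category.assoc, h₂]
    rw [zero_of_epi_comp p h₃, comp_zero]
  refine relativeExact_of_retraction hF { exact := ?_ } fun hc => ?_
  · rw [ShortComplex.exact_iff_exact_up_to_refinements]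
    intro T x hx
    have h₁ : (x ≫ biprod.fst) ≫ a + (x ≫ biprod.snd) ≫ s = 0 := by
      have : x ≫ biprod.desc a s = 0 := hx
      simpa only [biprod.desc_eq, Preadditive.comp_add, Category.assoc] using this
    have h₂ : (x ≫ biprod.snd) ≫ p = 0 := by
      have := h₁ =≫ b
      rwa [Preadditive.add_comp, Category.assoc, w, comp_zero, zero_add, Category.assoc, hs,
        zero_comp] at this
    obtain ⟨y, hy⟩ : ∃ y, y ≫ k = x ≫ biprod.snd :=
      ⟨hS'.1.exact.lift _ h₂, hS'.1.exact.lift_f _ h₂⟩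
    refine ⟨T, 𝟙 T, inferInstance, y, ?_⟩
    rw [Category.id_comp]
    apply biprod.hom_ext
    · rw [← cancel_mono a, ← sub_eq_zero, ← h₁, ← hy]
      simp [hk]
    · simp [hy]
  · obtain ⟨t⟩ := hS'.2 hc
    let r : F.obj P ⟶ F.obj K := t.r
    have hr : F.map k ≫ r = 𝟙 (F.obj K) := t.f_r
    refine ⟨F.map biprod.snd ≫ r, ?_⟩
    change F.map (biprod.lift (-h) k) ≫ F.map biprod.snd ≫ r = 𝟙 (F.obj K)
    rwa [← Functor.map_comp_assoc, biprod.lift_snd]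

lemma relativeExact_comp {X Y Z U V : A} {f : X ⟶ Y} {g : Y ⟶ U} {w : f ≫ g = 0} {f' : Y ⟶ Z}
    {g' : Z ⟶ V} {w' : f' ≫ g' = 0} (hS : relativeExact F c (ShortComplex.mk f g w))
    (hS' : relativeExact F c (ShortComplex.mk f' g' w')) :
    ∃ (W : A) (q : Z ⟶ W) (m : U ⟶ W) (n : W ⟶ V) (wq : (f ≫ f') ≫ q = 0) (wm : m ≫ n = 0),
      relativeExact F c (ShortComplex.mk (f ≫ f') q wq) ∧
        relativeExact F c (ShortComplex.mk m n wm) ∧ g ≫ m = f' ≫ q ∧ q ≫ n = g' := by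
  have : Mono f := hS.1.mono_f
  have : Epi g := hS.1.epi_g
  have : Mono f' := hS'.1.mono_f
  have : Epi g' := hS'.1.epi_g
  let q := cokernel.π (f ≫ f')
  have hq : f ≫ f' ≫ q = 0 := by rw [← Category.assoc, cokernel.condition]
  let n : cokernel (f ≫ f') ⟶ V := cokernel.desc _ g' (by simp [w'])
  have hn : q ≫ n = g' := cokernel.π_desc _ _ _
  obtain ⟨m, hm⟩ : ∃ m, g ≫ m = f' ≫ q := ⟨hS.1.exact.desc _ hq, hS.1.exact.g_desc _ hq⟩
  have hmn : m ≫ n = 0 := by rw [← cancel_epi g, reassoc_of% hm, hn, w', comp_zero]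
  have hc : (ShortComplex.mk (f ≫ f') q (cokernel.condition _)).ShortExact := shortExact_cokernel _
  have : Epi (q ≫ n) := by rwa [hn]
  have : Epi n := epi_of_epi q n
  have : Mono m := by
    refine Preadditive.mono_of_cancel_zero _ fun {T} a ha => ?_
    obtain ⟨T', π, hπ, y, hy⟩ := surjective_up_to_refinements_of_epi g a
    have h₁ : (y ≫ f') ≫ q = 0 := by
      rw [Category.assoc, ← hm, ← reassoc_of% hy, ha, comp_zero]
    obtain ⟨x, hx⟩ : ∃ x, x ≫ f ≫ f' = y ≫ f' := ⟨hc.exact.lift _ h₁, hc.exact.lift_f _ h₁⟩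
    rw [← Category.assoc, cancel_mono] at hx
    rw [← cancel_epi π, hy, ← hx, Category.assoc, w, comp_zero, comp_zero]
  refine ⟨_, q, m, n, cokernel.condition _, hmn, relativeExact_of_retraction hF hc fun h => ?_,
    relativeExact_of_section hF { exact := ?_ } fun h => ?_, hm, hn⟩
  · obtain ⟨s⟩ := hS.2 h
    obtain ⟨s'⟩ := hS'.2 h
    let r : F.obj Y ⟶ F.obj X := s.r
    let r' : F.obj Z ⟶ F.obj Y := s'.r
    have h₁ : F.map f' ≫ r' = 𝟙 (F.obj Y) := s'.f_r
    have h₂ : F.map f ≫ r = 𝟙 (F.obj X) := s.f_r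
    refine ⟨r' ≫ r, ?_⟩
    change F.map (f ≫ f') ≫ r' ≫ r = 𝟙 (F.obj X)
    rw [Functor.map_comp, Category.assoc, reassoc_of% h₁, h₂]
  · rw [ShortComplex.exact_iff_exact_up_to_refinements]
    intro T x hx
    obtain ⟨T', π, hπ, z, hz⟩ := surjective_up_to_refinements_of_epi q x
    have h₁ : z ≫ g' = 0 := by
      rw [← hn, ← reassoc_of% hz]
      exact (π ≫= hx).trans comp_zero
    obtain ⟨y, hy⟩ : ∃ y, y ≫ f' = z := ⟨hS'.1.exact.lift _ h₁, hS'.1.exact.lift_f _ h₁⟩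
    refine ⟨T', π, hπ, y ≫ g, ?_⟩
    change π ≫ x = (y ≫ g) ≫ m
    rw [hz, ← hy, Category.assoc, Category.assoc, hm]
  · obtain ⟨s'⟩ := hS'.2 h
    let t : F.obj V ⟶ F.obj Z := s'.s
    have ht : t ≫ F.map g' = 𝟙 (F.obj V) := s'.s_g
    refine ⟨t ≫ F.map q, ?_⟩
    change (t ≫ F.map q) ≫ F.map n = 𝟙 (F.obj V)
    rwa [Category.assoc, ← Functor.map_comp, hn]

/-- The sequences split by an exact functor form a Frobenius class as soon as there are enough
projective-injective objects. -/
lemma relativeExact_isFrobeniusClass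
    (hI : ∀ X : A, ∃ (I C : A) (i : X ⟶ I) (p : I ⟶ C) (w : i ≫ p = 0),
      relativeExact F c (ShortComplex.mk i p w) ∧ RelProjInj (relativeExact F c) I)
    (hP : ∀ X : A, ∃ (P K : A) (k : K ⟶ P) (p : P ⟶ X) (w : k ≫ p = 0),
      relativeExact F c (ShortComplex.mk k p w) ∧ RelProjInj (relativeExact F c) P) :
    IsFrobeniusClass (relativeExact F c) where
  mono hS := hS.1.mono_f
  epi hS := hS.1.epi_g
  lift {S} hS W a ha := by
    have := hS.1.mono_f
    exact ⟨hS.1.exact.lift a ha, hS.1.exact.lift_f a ha⟩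
  desc {S} hS W a ha := by
    have := hS.1.epi_g
    exact ⟨hS.1.exact.desc a ha, hS.1.exact.g_desc a ha⟩
  id_mem X := by
    refine relativeExact_of_retraction hF ?_ fun _ => ⟨𝟙 _, by simp⟩
    exact { exact := (ShortComplex.exact_iff_epi _ rfl).2 inferInstance, epi_g := ⟨fun _ _ _ =>
      (isZero_zero A).eq_of_src _ _⟩, mono_f := inferInstance }
  exists_injective := hI
  exists_projective := hP
  cone hS _ f := ⟨_, _, _, relativeExact_cone hF hS f⟩
  bicart_right := relativeExact_bicart_right hF
  bicart_left := relativeExact_bicart_left hF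
  comp := relativeExact_comp hF

end RelativeExact

/-! ### Modules over self-injective artinian rings -/

section SelfInjective

variable {R : Type u} [CommRing R] [IsArtinianRing R] [Module.Injective R R]
  {M : Type v} [AddCommGroup M] [Module R M]

/-- A self-injective artinian ring is a cogenerator: the maximal ideals of an artinian ring are
associated primes, so that a simple quotient of the cyclic module `R ∙ x` embeds into `R`, and the
resulting map extends to `M`. -/
lemma exists_linearMap_apply_ne_zero {x : M} (hx : x ≠ 0) : ∃ f : M →ₗ[R] R, f x ≠ 0 := by
  let t := LinearMap.toSpanSingleton R M x
  have ht : LinearMap.ker t ≠ ⊤ := fun h => hx (by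
    have h' : (1 : R) ∈ LinearMap.ker t := h ▸ trivial
    simpa [t] using h')
  obtain ⟨m, hm, hle⟩ := Ideal.exists_le_maximal _ ht
  have hmin : m ∈ (Module.annihilator R R).minimalPrimes :=
    IsArtinianRing.mem_minimalPrimes (by
      intro r hr
      have : r * 1 = 0 := Module.mem_annihilator.1 hr 1
      rw [mul_one] at this
      exact this ▸ m.zero_mem)
  obtain ⟨-, r, hr⟩ := isAssociatedPrime_iff.1
    (Module.associatedPrimes.minimalPrimes_annihilator_subset_associatedPrimes R R hmin)
  have hle' : LinearMap.ker t ≤ LinearMap.ker (LinearMap.toSpanSingleton R R r) := by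
    intro a ha
    have h := hle ha
    rw [hr, Submodule.mem_colon_singleton] at h
    simpa using h
  obtain ⟨f, hf⟩ := Module.Injective.extension_property R R _ _
    ((LinearMap.ker t).liftQ t le_rfl)
    (LinearMap.ker_eq_bot.1 (Submodule.ker_liftQ_eq_bot _ _ _ le_rfl))
    ((LinearMap.ker t).liftQ _ hle')
  refine ⟨f, fun h => hm.ne_top ((Ideal.eq_top_iff_one m).2 ?_)⟩
  have h₁ : f (t 1) = LinearMap.toSpanSingleton R R r 1 :=
    LinearMap.congr_fun hf (Submodule.Quotient.mk 1)
  have h₂ : f x = r := by simpa [t] using h₁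
  rw [hr, Submodule.mem_colon_singleton, ← h₂, h]
  simp

variable (R M) in
lemma exists_injective_linearMap_pi [Module.Finite R M] :
    ∃ (n : ℕ) (f : M →ₗ[R] Fin n → R), Function.Injective f := by
  obtain ⟨s, hs⟩ := Finset.exists_inf_le (fun f : M →ₗ[R] R => LinearMap.ker f)
  refine ⟨s.card, LinearMap.pi fun i => (s.equivFin.symm i).1, ?_⟩
  rw [injective_iff_map_eq_zero]
  intro x hx
  by_contra hne
  obtain ⟨f, hf⟩ := exists_linearMap_apply_ne_zero (R := R) hne
  refine hf (hs f ((Submodule.mem_finsetInf).2 fun g hg => ?_))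
  simpa using congrFun hx (s.equivFin ⟨g, hg⟩)

end SelfInjective

/-! ### Induction from the coefficient ring to the group algebra -/

section Induction

variable {R : Type u} [CommRing R] {G : Type v} [Group G]
  {M : Type u'} [AddCommGroup M] [Module R M]
  {N : Type v'} [AddCommGroup N] [Module R N] [Module (MonoidAlgebra R G) N]
  [IsScalarTower R (MonoidAlgebra R G) N]

/-- The `RG`-linear map `RG ⊗ M → N` which extends an `R`-linear map `M → N`. -/
noncomputable def inducedDesc (φ : M →ₗ[R] N) :
    MonoidAlgebra R G ⊗[R] M →ₗ[MonoidAlgebra R G] N :=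
  TensorProduct.AlgebraTensorModule.lift (LinearMap.toSpanSingleton _ _ φ)

omit [Module R N] [IsScalarTower R (MonoidAlgebra R G) N] in
lemma inducedHom_ext {f f' : MonoidAlgebra R G ⊗[R] M →ₗ[MonoidAlgebra R G] N}
    (h : ∀ m, f (1 ⊗ₜ m) = f' (1 ⊗ₜ m)) : f = f' := by
  ext x
  induction x using TensorProduct.induction_on with
  | zero => simp
  | add x y hx hy => rw [map_add, map_add, hx, hy]
  | tmul a m =>
    have key : a ⊗ₜ[R] m = a • (1 : MonoidAlgebra R G) ⊗ₜ[R] m := by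
      rw [TensorProduct.smul_tmul', smul_eq_mul, mul_one]
    rw [key, map_smul, map_smul, h]

variable (R G M) in
/-- The coefficient of `1 : G`, as a map `RG ⊗ M → M`. -/
noncomputable def inducedCoeffOne : MonoidAlgebra R G ⊗[R] M →ₗ[R] M :=
  TensorProduct.lift (LinearMap.lsmul R M ∘ₗ
    Finsupp.lapply 1 ∘ₗ (MonoidAlgebra.coeffLinearEquiv R).toLinearMap)

@[simp]
lemma inducedCoeffOne_tmul (a : MonoidAlgebra R G) (m : M) :
    inducedCoeffOne R G M (a ⊗ₜ m) = a.coeff 1 • m := rfl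

variable [Finite G]

open Classical in
/-- The `RG`-linear map `N → RG ⊗ M` with coefficient `φ` at `1 : G`, for an `R`-linear map
`φ : N → M`. It exists because `G` is finite, so that induction and coinduction agree. -/
noncomputable def inducedLift (φ : N →ₗ[R] M) :
    N →ₗ[MonoidAlgebra R G] MonoidAlgebra R G ⊗[R] M :=
  let _ := Fintype.ofFinite G
  { toFun n := ∑ g : G, MonoidAlgebra.of R G g ⊗ₜ φ (MonoidAlgebra.of R G g⁻¹ • n)
    map_add' n n' := by
      simp only [smul_add, map_add, TensorProduct.tmul_add, Finset.sum_add_distrib]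
    map_smul' a n := by
      induction a using MonoidAlgebra.induction_on with
      | of h =>
        rw [Finset.smul_sum, ← Equiv.sum_comp (Equiv.mulLeft h)]
        refine Finset.sum_congr rfl fun g _ => ?_
        rw [RingHom.id_apply, TensorProduct.smul_tmul', smul_eq_mul, ← map_mul, smul_smul,
          ← map_mul]
        simp
      | add a b ha hb =>
        simp only [RingHom.id_apply] at ha hb ⊢
        simp only [add_smul, ← ha, ← hb, smul_add, map_add, TensorProduct.tmul_add,
          Finset.sum_add_distrib]
      | smul r a ha =>
        simp only [RingHom.id_apply] at ha ⊢
        rw [smul_assoc, smul_assoc, ← ha, Finset.smul_sum]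
        refine Finset.sum_congr rfl fun g _ => ?_
        rw [← TensorProduct.tmul_smul, ← map_smul, smul_algebra_smul_comm] }

lemma inducedLift_apply [Fintype G] (φ : N →ₗ[R] M) (n : N) :
    inducedLift φ n = ∑ g : G, MonoidAlgebra.of R G g ⊗ₜ[R] φ (MonoidAlgebra.of R G g⁻¹ • n) := by
  obtain rfl := Subsingleton.elim (Fintype.ofFinite G) ‹Fintype G›
  rfl

lemma inducedLift_comp {N' : Type*} [AddCommGroup N'] [Module R N'] [Module (MonoidAlgebra R G) N']
    [IsScalarTower R (MonoidAlgebra R G) N'] (φ : N →ₗ[R] M) (f : N' →ₗ[MonoidAlgebra R G] N)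
    (n : N') :
    inducedLift (G := G) (φ ∘ₗ f.restrictScalars R) n = inducedLift φ (f n) := by
  have := Fintype.ofFinite G
  simp [inducedLift_apply]

@[simp]
lemma inducedCoeffOne_inducedLift (φ : N →ₗ[R] M) (n : N) :
    inducedCoeffOne R G M (inducedLift φ n) = φ n := by
  have := Fintype.ofFinite G
  rw [inducedLift_apply, map_sum, Finset.sum_eq_single 1]
  · simp [← MonoidAlgebra.one_def]
  · intro g _ hg
    simp [hg]
  · simp

/-- An `RG`-linear map into `RG ⊗ M` is determined by its coefficient at `1 : G`. -/
lemma inducedLift_inducedCoeffOne (ψ : N →ₗ[MonoidAlgebra R G] MonoidAlgebra R G ⊗[R] M) (n : N) :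
    inducedLift (inducedCoeffOne R G M ∘ₗ ψ.restrictScalars R) n = ψ n := by
  have := Fintype.ofFinite G
  rw [inducedLift_apply]
  simp only [LinearMap.comp_apply, LinearMap.restrictScalars_apply, map_smul]
  induction ψ n using TensorProduct.induction_on with
  | zero => simp
  | add x y hx hy =>
    simp only [smul_add, map_add, TensorProduct.tmul_add, Finset.sum_add_distrib, hx, hy]
  | tmul a m =>
    induction a using MonoidAlgebra.induction_on with
    | of h =>
      rw [Finset.sum_eq_single h]
      · rw [TensorProduct.smul_tmul', smul_eq_mul, ← map_mul]
        simp
      · intro g _ hg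
        rw [TensorProduct.smul_tmul', smul_eq_mul, ← map_mul]
        simp [inv_mul_eq_one, hg]
      · simp
    | add a b ha hb =>
      simp only [TensorProduct.add_tmul, smul_add, map_add, TensorProduct.tmul_add,
        Finset.sum_add_distrib, ha, hb]
    | smul r a ha =>
      rw [← TensorProduct.smul_tmul']
      conv_rhs => rw [← ha, Finset.smul_sum]
      refine Finset.sum_congr rfl fun g _ => ?_
      rw [smul_algebra_smul_comm, map_smul, TensorProduct.tmul_smul]

end Induction

/-! ### The two exact structures on modules over the group algebra -/

section GroupAlgebra

variable (R : Type u) [CommRing R] (G : Type v) [Group G]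

instance restrictToR_additive : (restrictToR R G).Additive where
  map_add := rfl

section Exactness

variable [IsNoetherianRing R] [Finite G]

instance isNoetherianRing_monoidAlgebra : IsNoetherianRing (MonoidAlgebra R G) :=
  isNoetherian_of_tower R inferInstance

variable {R G}

lemma shortExactRG_iff (S : ShortComplex (ModRG R G)) : shortExactRG R G S ↔ S.ShortExact :=
  CategoryTheory.ShortExact.shortExact_map_iff _

lemma shortExact_map_restrictToR {S : ShortComplex (ModRG R G)} (hS : S.ShortExact) :
    (S.map (restrictToR R G)).ShortExact := by
  have h := (shortExactRG_iff S).2 hS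
  have h' := (ShortComplex.ShortExact.moduleCat_exact_iff_function_exact _).1 h.exact
  exact {
    exact := (ShortComplex.ShortExact.moduleCat_exact_iff_function_exact _).2 h'
    mono_f := (ModuleCat.mono_iff_injective _).2 h.moduleCat_injective_f
    epi_g := (ModuleCat.epi_iff_surjective _).2 h.moduleCat_surjective_g }

variable (R G)

lemma shortExactRG_eq_relativeExact :
    shortExactRG R G = relativeExact (restrictToR R G) False := by
  ext S
  rw [shortExactRG_iff]
  exact ⟨fun h => ⟨h, False.elim⟩, And.left⟩

lemma splitExactRG_eq_relativeExact :
    splitExactRG R G = relativeExact (restrictToR R G) True := by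
  ext S
  exact and_congr (shortExactRG_iff S) (by simp)

end Exactness

/-! ### Induced modules are relatively projective and injective -/

instance module_restrictToR (X : ModRG R G) :
    Module (MonoidAlgebra R G) ((restrictToR R G).obj X) :=
  inferInstanceAs (Module (MonoidAlgebra R G) X)

instance isScalarTower_restrictToR (X : ModRG R G) :
    IsScalarTower R (MonoidAlgebra R G) ((restrictToR R G).obj X) where
  smul_assoc r a x := by
    rw [Algebra.smul_def, mul_smul]
    rfl

instance finite_restrictToR [Finite G] (X : ModRG R G) :
    Module.Finite R ((restrictToR R G).obj X) :=
  have : Module.Finite (MonoidAlgebra R G) ((restrictToR R G).obj X) :=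
    inferInstanceAs (Module.Finite (MonoidAlgebra R G) X)
  Module.Finite.trans (MonoidAlgebra R G) _

variable {R G} [IsNoetherianRing R] [Finite G] {c : Prop}

lemma exists_lift_restrictToR {S : ShortComplex (ModRG R G)}
    (hS : relativeExact (restrictToR R G) c S) {M : Type*} [AddCommGroup M] [Module R M]
    (hM : c ∨ Module.Projective R M) (φ : M →ₗ[R] (restrictToR R G).obj S.X₃) :
    ∃ ψ : M →ₗ[R] (restrictToR R G).obj S.X₂,
      ((restrictToR R G).map S.g).hom ∘ₗ ψ = φ := by
  obtain hc | hM := hM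
  · obtain ⟨s⟩ := hS.2 hc
    let t : (restrictToR R G).obj S.X₃ →ₗ[R] (restrictToR R G).obj S.X₂ := s.s.hom
    have ht : ((restrictToR R G).map S.g).hom ∘ₗ t = LinearMap.id :=
      congrArg ModuleCat.Hom.hom s.s_g
    exact ⟨t ∘ₗ φ, by rw [← LinearMap.comp_assoc, ht, LinearMap.id_comp]⟩
  · exact Module.projective_lifting_property _ φ
      (shortExact_map_restrictToR hS.1).moduleCat_surjective_g

lemma exists_extend_restrictToR {S : ShortComplex (ModRG R G)}
    (hS : relativeExact (restrictToR R G) c S) {M : Type (max u v)} [AddCommGroup M] [Module R M]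
    (hM : c ∨ Module.Injective R M) (φ : (restrictToR R G).obj S.X₁ →ₗ[R] M) :
    ∃ ψ : (restrictToR R G).obj S.X₂ →ₗ[R] M,
      ψ ∘ₗ ((restrictToR R G).map S.f).hom = φ := by
  obtain hc | hM := hM
  · obtain ⟨s⟩ := hS.2 hc
    let t : (restrictToR R G).obj S.X₂ →ₗ[R] (restrictToR R G).obj S.X₁ := s.r.hom
    have ht : t ∘ₗ ((restrictToR R G).map S.f).hom = LinearMap.id :=
      congrArg ModuleCat.Hom.hom s.f_r
    exact ⟨φ ∘ₗ t, by rw [LinearMap.comp_assoc, ht, LinearMap.comp_id]⟩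
  · exact Module.Injective.extension_property R M _ _ _
      (shortExact_map_restrictToR hS.1).moduleCat_injective_f φ

/-- The `R`-linear map `m ↦ 1 ⊗ m` to the restriction of an induced module. -/
noncomputable def inducedModuleUnit (M : FGModuleCat.{max u v} R) :
    M →ₗ[R] (restrictToR R G).obj (inducedModule R G M) where
  toFun m := (1 : MonoidAlgebra R G) ⊗ₜ[R] m
  map_add' := TensorProduct.tmul_add _
  map_smul' r m := (TensorProduct.tmul_smul r _ m).trans
    (algebraMap_smul (MonoidAlgebra R G) r ((1 : MonoidAlgebra R G) ⊗ₜ[R] m)).symm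

/-- The coefficient of `1 : G`, on the restriction of an induced module. -/
noncomputable def inducedModuleCounit (M : FGModuleCat.{max u v} R) :
    (restrictToR R G).obj (inducedModule R G M) →ₗ[R] M where
  toFun := inducedCoeffOne R G M
  map_add' := map_add _
  map_smul' r x := by
    have h : r • x = (r • (show MonoidAlgebra R G ⊗[R] M from x) : MonoidAlgebra R G ⊗[R] M) :=
      algebraMap_smul (MonoidAlgebra R G) r (show MonoidAlgebra R G ⊗[R] M from x)
    rw [h]
    exact map_smul (inducedCoeffOne R G M) r _

/-- The map from an induced module which extends an `R`-linear map. -/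
noncomputable def inducedModuleDesc {M : FGModuleCat.{max u v} R} {X : ModRG R G}
    (φ : M →ₗ[R] (restrictToR R G).obj X) : inducedModule R G M ⟶ X :=
  FGModuleCat.ofHom (inducedDesc φ : _ →ₗ[MonoidAlgebra R G] (restrictToR R G).obj X)

/-- The map to an induced module with a given coefficient at `1 : G`. -/
noncomputable def inducedModuleLift {M : FGModuleCat.{max u v} R} {X : ModRG R G}
    (φ : (restrictToR R G).obj X →ₗ[R] M) : X ⟶ inducedModule R G M :=
  FGModuleCat.ofHom (inducedLift φ : (restrictToR R G).obj X →ₗ[MonoidAlgebra R G] _)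

lemma inducedModule_relProjective (M : FGModuleCat.{max u v} R) (hM : c ∨ Module.Projective R M) :
    RelProjective (relativeExact (restrictToR R G) c) (inducedModule R G M) := by
  intro S hS a
  obtain ⟨ψ, hψ⟩ := exists_lift_restrictToR hS hM
    (((restrictToR R G).map a).hom ∘ₗ inducedModuleUnit M)
  refine ⟨inducedModuleDesc ψ, FGModuleCat.hom_ext (inducedHom_ext fun m => ?_)⟩
  refine Eq.trans ?_ (LinearMap.congr_fun hψ m)
  exact congrArg S.g.hom.hom (one_smul (MonoidAlgebra R G) (ψ m))

lemma inducedModule_relInjective (M : FGModuleCat.{max u v} R) (hM : c ∨ Module.Injective R M) :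
    RelInjective (relativeExact (restrictToR R G) c) (inducedModule R G M) := by
  intro S hS a
  obtain ⟨ψ, hψ⟩ := exists_extend_restrictToR hS hM
    (inducedModuleCounit M ∘ₗ ((restrictToR R G).map a).hom)
  refine ⟨inducedModuleLift ψ, FGModuleCat.hom_ext (LinearMap.ext fun x => ?_)⟩
  let f : (restrictToR R G).obj S.X₁ →ₗ[MonoidAlgebra R G] (restrictToR R G).obj S.X₂ := S.f.hom.hom
  let a' : (restrictToR R G).obj S.X₁ →ₗ[MonoidAlgebra R G] MonoidAlgebra R G ⊗[R] M := a.hom.hom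
  have h : ψ ∘ₗ f.restrictScalars R = inducedCoeffOne R G M ∘ₗ a'.restrictScalars R :=
    LinearMap.ext (LinearMap.congr_fun hψ)
  have h₁ (y : (restrictToR R G).obj S.X₁) : a' y = inducedLift ψ (f y) := by
    rw [← inducedLift_comp, h, inducedLift_inducedCoeffOne]
  exact (h₁ x).symm

/-- An `R`-linear embedding of `X` into `M`, which splits in case `c` holds, induces an embedding of
`X` into the module induced from `M`. -/
lemma exists_relativeExact_inducedModuleLift {M : FGModuleCat.{max u v} R} {X : ModRG R G}
    (φ : (restrictToR R G).obj X →ₗ[R] M) (hφ : Function.Injective φ)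
    (hc : c → ∃ r : M →ₗ[R] (restrictToR R G).obj X, r ∘ₗ φ = LinearMap.id) :
    ∃ (C : ModRG R G) (p : inducedModule R G M ⟶ C) (w : inducedModuleLift φ ≫ p = 0),
      relativeExact (restrictToR R G) c (ShortComplex.mk (inducedModuleLift φ) p w) := by
  have hu : inducedModuleCounit M ∘ₗ ((restrictToR R G).map (inducedModuleLift φ)).hom = φ :=
    LinearMap.ext fun x => inducedCoeffOne_inducedLift φ x
  have : Mono (inducedModuleLift φ) := by
    have : Mono ((restrictToR R G).map (inducedModuleLift φ)) := by
      rw [ModuleCat.mono_iff_injective]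
      refine Function.Injective.of_comp (f := inducedModuleCounit M) ?_
      rwa [← hu] at hφ
    exact (restrictToR R G).mono_of_mono_map this
  refine ⟨_, _, _, relativeExact_of_retraction (fun S => shortExact_map_restrictToR)
    (shortExact_cokernel _) fun h => ?_⟩
  obtain ⟨r, hr⟩ := hc h
  let t : (restrictToR R G).obj (inducedModule R G M) ⟶ (restrictToR R G).obj X :=
    ModuleCat.ofHom (X := (restrictToR R G).obj (inducedModule R G M))
      (Y := (restrictToR R G).obj X) (r ∘ₗ inducedModuleCounit M)
  refine ⟨t, ModuleCat.hom_ext ?_⟩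
  change (r ∘ₗ inducedModuleCounit M) ∘ₗ ((restrictToR R G).map (inducedModuleLift φ)).hom = _
  rw [LinearMap.comp_assoc, hu, hr]
  rfl

lemma exists_relativeExact_inducedModuleDesc {M : FGModuleCat.{max u v} R} {X : ModRG R G}
    (φ : M →ₗ[R] (restrictToR R G).obj X) (hφ : Function.Surjective φ)
    (hc : c → ∃ s : (restrictToR R G).obj X →ₗ[R] M, φ ∘ₗ s = LinearMap.id) :
    ∃ (K : ModRG R G) (k : K ⟶ inducedModule R G M) (w : k ≫ inducedModuleDesc φ = 0),
      relativeExact (restrictToR R G) c (ShortComplex.mk k (inducedModuleDesc φ) w) := by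
  have hu : ((restrictToR R G).map (inducedModuleDesc φ)).hom ∘ₗ inducedModuleUnit M = φ :=
    LinearMap.ext fun x => one_smul (MonoidAlgebra R G) (φ x)
  have : Epi (inducedModuleDesc φ) := by
    have : Epi ((restrictToR R G).map (inducedModuleDesc φ)) := by
      rw [ModuleCat.epi_iff_surjective]
      refine Function.Surjective.of_comp (g := inducedModuleUnit M) ?_
      rwa [← hu] at hφ
    exact (restrictToR R G).epi_of_epi_map this
  refine ⟨_, _, _, relativeExact_of_section (fun S => shortExact_map_restrictToR)
    (shortExact_kernel _) fun h => ?_⟩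
  obtain ⟨s, hs⟩ := hc h
  let t : (restrictToR R G).obj X ⟶ (restrictToR R G).obj (inducedModule R G M) :=
    ModuleCat.ofHom (X := (restrictToR R G).obj X)
      (Y := (restrictToR R G).obj (inducedModule R G M)) (inducedModuleUnit M ∘ₗ s)
  refine ⟨t, ModuleCat.hom_ext ?_⟩
  change ((restrictToR R G).map (inducedModuleDesc φ)).hom ∘ₗ (inducedModuleUnit M ∘ₗ s) = _
  rw [← LinearMap.comp_assoc, hu, hs]
  rfl

/-! ### The Frobenius classes -/

variable (R G) in
lemma splitExactRG_exists_injective (X : ModRG R G) :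
    ∃ (M : FGModuleCat.{max u v} R) (C : ModRG R G) (i : X ⟶ inducedModule R G M)
      (p : inducedModule R G M ⟶ C) (w : i ≫ p = 0),
      splitExactRG R G (ShortComplex.mk i p w) ∧
        RelProjInj (splitExactRG R G) (inducedModule R G M) := by
  rw [splitExactRG_eq_relativeExact]
  let M := FGModuleCat.of R ((restrictToR R G).obj X)
  obtain ⟨C, p, w, h⟩ := exists_relativeExact_inducedModuleLift (c := True) (M := M) (X := X)
    (LinearMap.id : _ →ₗ[R] (restrictToR R G).obj X) Function.injective_id
    fun _ => ⟨LinearMap.id, LinearMap.id_comp _⟩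
  exact ⟨M, C, _, p, w, h, inducedModule_relProjective M (.inl trivial),
    inducedModule_relInjective M (.inl trivial)⟩

variable (R G) in
lemma splitExactRG_isFrobeniusClass : IsFrobeniusClass (splitExactRG R G) := by
  have hI := splitExactRG_exists_injective R G
  rw [splitExactRG_eq_relativeExact] at hI ⊢
  refine relativeExact_isFrobeniusClass (fun S => shortExact_map_restrictToR) (fun X => ?_)
    (fun X => ?_)
  · obtain ⟨M, C, i, p, w, h⟩ := hI X
    exact ⟨_, C, i, p, w, h⟩
  · let M := FGModuleCat.of R ((restrictToR R G).obj X)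
    obtain ⟨K, k, w, h⟩ := exists_relativeExact_inducedModuleDesc (c := True) (M := M) (X := X)
      (LinearMap.id : _ →ₗ[R] (restrictToR R G).obj X) Function.surjective_id
      fun _ => ⟨LinearMap.id, LinearMap.id_comp _⟩
    exact ⟨_, K, k, _, w, h, inducedModule_relProjective M (.inl trivial),
      inducedModule_relInjective M (.inl trivial)⟩

variable (R G) in
lemma shortExactRG_isFrobeniusClass [IsArtinianRing R] [Module.Injective R R] :
    IsFrobeniusClass (shortExactRG R G) := by
  rw [shortExactRG_eq_relativeExact]
  -- the free module `R ^ n`, in the universe of `mod RG`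
  let M (n : ℕ) := FGModuleCat.of R (ULift.{max u v} (Fin n → R))
  have hM (n : ℕ) : RelProjInj (relativeExact (restrictToR R G) False) (inducedModule R G (M n)) :=
    ⟨inducedModule_relProjective _ (.inr (inferInstanceAs
        (Module.Projective R (ULift.{max u v} (Fin n → R))))),
      inducedModule_relInjective _ (.inr (Module.ulift_injective_of_injective R inferInstance))⟩
  refine relativeExact_isFrobeniusClass (fun S => shortExact_map_restrictToR) (fun X => ?_)
    (fun X => ?_)
  · obtain ⟨n, f, hf⟩ := exists_injective_linearMap_pi R ((restrictToR R G).obj X)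
    obtain ⟨C, p, w, h⟩ := exists_relativeExact_inducedModuleLift (c := False) (M := M n) (X := X)
      (ULift.moduleEquiv.symm.toLinearMap ∘ₗ f) (ULift.moduleEquiv.symm.injective.comp hf)
      False.elim
    exact ⟨_, C, _, p, w, h, hM n⟩
  · obtain ⟨n, f, hf⟩ := Module.Finite.exists_fin' R ((restrictToR R G).obj X)
    obtain ⟨K, k, w, h⟩ := exists_relativeExact_inducedModuleDesc (c := False) (M := M n) (X := X)
      (f ∘ₗ ULift.moduleEquiv.toLinearMap) (hf.comp ULift.moduleEquiv.surjective) False.elim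
    exact ⟨_, K, k, _, w, h, hM n⟩

/-- The relatively projective-injective modules are direct summands of induced modules. -/
lemma thickK_of_relProjInj [StableTriangulation (shortExactRG R G)] (J : ModRG R G)
    (hJ : RelProjInj (splitExactRG R G) J) :
    thickK R G ((toStable (shortExactRG R G)).obj J) := by
  obtain ⟨M, C, i, p, w, hS, -⟩ := splitExactRG_exists_injective R G J
  obtain ⟨r, hr⟩ := hJ.2 _ hS (𝟙 J)
  exact (thickK R G).prop_of_retract
    ((Retract.mk i r hr).map (toStable (shortExactRG R G)))
    (ObjectProperty.le_triangEnvelope _ _ ⟨M, rfl⟩)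

end GroupAlgebra

theorem theorem3p4 (R : Type u) [CommRing R] [IsArtinianRing R] [Module.Injective R R]
    (G : Type v) [Group G] [Finite G] :
    Nonempty (StableTriangulation (splitExactRG R G)) ∧
    Nonempty (StableTriangulation (shortExactRG R G)) ∧
    ∀ [StableTriangulation (splitExactRG R G)] [StableTriangulation (shortExactRG R G)],
      ∃ (_ : (thickK' R G).IsTriangulated) (_ : (thickK' R G).IsStableUnderRetracts)
        (ψ : StBik R G ⥤ (thickK R G).trW.Localization) (_ : ψ.CommShift ℤ)
        (φ : (thickK' R G).trW.Localization ⥤ (thickK R G).trW.Localization)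
        (_ : φ.CommShift ℤ) (e : (thickK' R G).trW.Q ⋙ φ ≅ ψ),
        Nonempty (toStable (splitExactRG R G) ⋙ ψ ≅
          toStable (shortExactRG R G) ⋙ (thickK R G).trW.Q) ∧
        ψ.IsTriangulated ∧ φ.IsTriangulated ∧ NatTrans.CommShift e.hom ℤ ∧
        φ.IsEquivalence := by
  refine ⟨(splitExactRG_isFrobeniusClass R G).nonempty_stableTriangulation,
    (shortExactRG_isFrobeniusClass R G).nonempty_stableTriangulation, ?_⟩
  intro _ _
  exact exists_verdierQuotient_equivalence (thickK R G) (splitExactRG_isFrobeniusClass R G)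
    (fun _ hS => hS.1) thickK_of_relProjInj
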